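/- **Theorem 3.** Let $\Lambda\subset\mathbb R^m$ be a set of parameters and let $\mathcal X_\lambda=P(x,y;\lambda)\partial_x+Q(x,y;\lambda)\partial_y$, $\lambda\in\Lambda$, be a family of planar vector fields with $P,Q$ real analytic in $(x,y,\lambda)$ near every point $(0,0,\lambda)$, $\lambda\in\Lambda$. Let $p,q\ge 1$ be coprime weights. For a function $f$ analytic at the origin write $f=\sum_j f_j$ for its $(p,q)$-quasihomogeneous expansion, $f_j$ being the sum of the terms $c\,x^ay^b$ of the Taylor series of $f$ with $pa+qb=j$. Assume that, for a fixed integer $r\ge 0$ and for every $\lambda\in\Lambda$, $\mathcal X_\lambda$ belongs to the monodromic class $\mathrm{Mo}^{(p,q)}$ with leading degree $r$: one has $\mathcal X_\lambda=\mathcal X_r+\mathcal X_{r+1}+\cdots$ with $\mathcal X_j=P_{p+j}\partial_x+Q_{q+j}\partial_y$, and $\mathcal X_r$ has a monodromic singularity at the origin (a singular point around which the local flow turns). Let $F(x,y;\lambda)$ be analytic in $(x,y,\lambda)$ near every $(0,0,\lambda)$, $\lambda\in\Lambda$, with $F(0,0;\lambda)=0$ and, for a fixed $s$ and all $\lambda\in\Lambda$,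 with quasihomogeneous expansion $F=F_s+\cdots$, $F_s\not\equiv0$. Assume that $F=0$ is an invariant curve: for every $\lambda\in\Lambda$ there is a cofactor $K$, analytic in $(x,y)$ at the origin, with $P F_x+Q F_y=KF$ near the origin. In weighted polar coordinates $x=\rho^p\cos\varphi$, $y=\rho^q\sin\varphi$, after removal of the factor $\rho^r/D(\varphi)$, $D(\varphi)=p\cos^2\varphi+q\sin^2\varphi$, the vector field becomes $\dot\rho=R(\varphi,\rho)$, $\dot\varphi=\Theta(\varphi,\rho)$. Let $\rho(\varphi;\rho_0)$ be the solution of $d\rho/d\varphi=R/\Theta$, $\rho(0;\rho_0)=\rho_0>0$, let $\Pi(\rho_0)=\rho(2\pi;\rho_0)$ be the Poincaré map, and let $\hat K(\varphi,\rho)=D(\varphi)K(\rho^p\cos\varphi,\rho^q\sin\varphi)/(\rho^r\Theta(\varphi,\rho))$. Then $K_j\equiv0$ for all $j<r$, that is, $K=K_{\bar r}+\cdots$ with $\bar r\ge r$. Moreover there are functions $\eta_i$ $(i\ge1)$ and $\beta_i$ $(i\ge0)$, analytic in $\lambda$ near every point of $\Lambda$ and with $\eta_1>0$ on $\Lambda$,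 such that for every $\lambda\in\Lambda$ and every sufficiently small $\rho_0>0$ the solution $\rho(\varphi;\rho_0)$ exists, is unique and positive on $[0,2\pi]$, $\Theta$ does not vanish along it, $\hat K(\varphi,\rho(\varphi;\rho_0))$ is continuous on $[0,2\pi]$ (the integral below is not singular), and the following series converge: $$\int_0^{2\pi}\hat K(\varphi,\rho(\varphi;\rho_0))\,d\varphi=\sum_{i\ge0}\beta_i\rho_0^i,\qquad \Pi(\rho_0)=\sum_{i\ge1}\eta_i\rho_0^i .$$ For every integer $\bar r\ge r$ such that $K_j\equiv0$ for all $j<\bar r$ and all $\lambda\in\Lambda$ (in particular for the degree of the leading term of $K=K_{\bar r}+\cdots$) one has on $\Lambda$ that $\beta_i=0$ for $i<\bar r-r$, and: (i) If $\bar r=r$, then $\beta_0=\log(\eta_1^s)$ and $\beta_i\equiv s\,\eta_{i+1}\pmod{\langle\eta_1-1,\eta_2,\dots,\eta_i\rangle}$ for $i>0$. (ii) If $\bar r>r$, then $\eta_1=1$, $\eta_2=\dots=\eta_{\bar r-r}=0$, $\beta_{\bar r-r}=s\,\eta_{\bar r-r+1}$, and $\beta_i\equiv s\,\eta_{i+1}\pmod{\langle\eta_{\bar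 r-r+1},\dots,\eta_i\rangle}$ for $i>\bar r-r$. The congruences hold, at every $\lambda^*\in\Lambda$, in the ring of germs at $\lambda^*$ of analytic functions of $\lambda$, regarded as functions on $\Lambda$. -/

import Mathlib

open Filter Topology Set

noncomputable section

namespace MonodromicClass

/-- The Taylor coefficient at the origin of the monomial `x ^ a * y ^ b` of a function of two
real variables. -/
def taylorCoeff (f : ℝ → ℝ → ℝ) (a b : ℕ) : ℝ :=
  iteratedDeriv a (fun x => iteratedDeriv b (fun y => f x y) 0) 0 /
    ((a.factorial : ℝ) * (b.factorial : ℝ))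

/-- The `(p,q)`-quasihomogeneous component of degree `j` of a function `f` which is analytic at
the origin: the sum of the terms `c x ^ a y ^ b` of its Taylor series with `p a + q b = j`
(for positive weights, such a term has `a ≤ j` and `b ≤ j`). -/
def qhPart (p q : ℕ) (f : ℝ → ℝ → ℝ) (j : ℕ) (x y : ℝ) : ℝ :=
  ∑ ab ∈ (Finset.range (j + 1) ×ˢ Finset.range (j + 1)).filter
      (fun ab : ℕ × ℕ => p * ab.1 + q * ab.2 = j),
    taylorCoeff f ab.1 ab.2 * x ^ ab.1 * y ^ ab.2

/-- The `(p,q)`-quasihomogeneous expansion of `f` is `f = f_n + ⋯`, i.e. the components of degree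
smaller than `n` vanish identically (`f_n` itself may vanish). -/
def StartsAt (p q : ℕ) (f : ℝ → ℝ → ℝ) (n : ℕ) : Prop :=
  ∀ j < n, ∀ x y : ℝ, qhPart p q f j x y = 0

/-- The origin is a monodromic singularity of the vector field `P ∂x + Q ∂y`: it is a singular
point and the local flow turns around it, that is, every orbit through a point close enough to the
origin makes a complete turn around the origin while staying arbitrarily close to it. Here `R` and
`θ` are a polar radius and a continuous polar angle along the orbit `t ↦ (x t, y t)`. -/
def IsMonodromic (P Q : ℝ → ℝ → ℝ) : Prop :=
  P 0 0 = 0 ∧ Q 0 0 = 0 ∧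
  ∀ ε > 0, ∃ δ > 0, ∀ x₀ y₀ : ℝ, 0 < x₀ ^ 2 + y₀ ^ 2 → x₀ ^ 2 + y₀ ^ 2 < δ ^ 2 →
    ∃ T > 0, ∃ x y R θ : ℝ → ℝ,
      x 0 = x₀ ∧ y 0 = y₀ ∧ ContinuousOn θ (Icc 0 T) ∧
      (∀ t ∈ Icc 0 T,
        HasDerivWithinAt x (P (x t) (y t)) (Icc 0 T) t ∧
        HasDerivWithinAt y (Q (x t) (y t)) (Icc 0 T) t ∧
        0 < R t ∧ R t < ε ∧
        x t = R t * Real.cos (θ t) ∧ y t = R t * Real.sin (θ t)) ∧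
      |θ T - θ 0| = 2 * Real.pi

/-- The vector field `P ∂x + Q ∂y` belongs to the monodromic class `Mo^(p,q)`, with leading degree
`r`: its `(p,q)`-quasihomogeneous expansion is `X = X_r + ⋯`, where
`X_j = P_{p+j} ∂x + Q_{q+j} ∂y`, and the leading part `X_r` has a monodromic singularity at the
origin (so `X_r` is not identically zero). -/
structure InMo (p q r : ℕ) (P Q : ℝ → ℝ → ℝ) : Prop where
  startsAt_fst : StartsAt p q P (p + r)
  startsAt_snd : StartsAt p q Q (q + r)
  monodromic : IsMonodromic (qhPart p q P (p + r)) (qhPart p q Q (q + r))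

/-- `K` is a cofactor of `F` for the vector field `X = P ∂x + Q ∂y`: both are analytic at the
origin of the plane and `X(F) = K F` holds in a neighbourhood of it. -/
structure IsCofactor (P Q F K : ℝ → ℝ → ℝ) : Prop where
  analyticAt_curve : AnalyticAt ℝ (fun z : ℝ × ℝ => F z.1 z.2) (0, 0)
  analyticAt_cofactor : AnalyticAt ℝ (fun z : ℝ × ℝ => K z.1 z.2) (0, 0)
  eq : ∀ᶠ z : ℝ × ℝ in 𝓝 (0, 0),
    P z.1 z.2 * deriv (fun x => F x z.2) z.1 + Q z.1 z.2 * deriv (fun y => F z.1 y) z.2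
      = K z.1 z.2 * F z.1 z.2

/-- `D(φ) = p cos² φ + q sin² φ`. -/
def polarD (p q : ℕ) (φ : ℝ) : ℝ := p * Real.cos φ ^ 2 + q * Real.sin φ ^ 2

/-- The radial component `R(φ, ρ)`, for `ρ > 0`, of the vector field `P ∂x + Q ∂y` in weighted
polar coordinates `x = ρ ^ p cos φ`, `y = ρ ^ q sin φ`, after the positive factor `ρ ^ r / D(φ)`
has been removed. -/
def polarR (p q r : ℕ) (P Q : ℝ → ℝ → ℝ) (φ ρ : ℝ) : ℝ :=
  (ρ ^ q * Real.cos φ * P (ρ ^ p * Real.cos φ) (ρ ^ q * Real.sin φ)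
    + ρ ^ p * Real.sin φ * Q (ρ ^ p * Real.cos φ) (ρ ^ q * Real.sin φ)) * ρ
    / ρ ^ (p + q + r)

/-- The angular component `Θ(φ, ρ)`, for `ρ > 0`, of the same vector field. -/
def polarTheta (p q r : ℕ) (P Q : ℝ → ℝ → ℝ) (φ ρ : ℝ) : ℝ :=
  (p * ρ ^ p * Real.cos φ * Q (ρ ^ p * Real.cos φ) (ρ ^ q * Real.sin φ)
    - q * ρ ^ q * Real.sin φ * P (ρ ^ p * Real.cos φ) (ρ ^ q * Real.sin φ))
    / ρ ^ (p + q + r)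

/-- The function `ρ` is, on `[0, 2π]`, a positive solution of the Cauchy problem
`dρ/dφ = R(φ, ρ) / Θ(φ, ρ)`, `ρ(0) = ρ₀`, that stays where `Θ` does not vanish. -/
def IsPolarSolution (p q r : ℕ) (P Q : ℝ → ℝ → ℝ) (ρ₀ : ℝ) (ρ : ℝ → ℝ) : Prop :=
  ρ 0 = ρ₀ ∧ ∀ φ ∈ Icc 0 (2 * Real.pi),
    0 < ρ φ ∧ polarTheta p q r P Q φ (ρ φ) ≠ 0 ∧
    HasDerivWithinAt ρ (polarR p q r P Q φ (ρ φ) / polarTheta p q r P Q φ (ρ φ))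
      (Icc 0 (2 * Real.pi)) φ

/-- The transformed cofactor
`K̂(φ, ρ) = D(φ) K(ρ ^ p cos φ, ρ ^ q sin φ) / (ρ ^ r Θ(φ, ρ))`, for `ρ > 0`. -/
def polarCofactor (p q r : ℕ) (P Q K : ℝ → ℝ → ℝ) (φ ρ : ℝ) : ℝ :=
  polarD p q φ * K (ρ ^ p * Real.cos φ) (ρ ^ q * Real.sin φ)
    / (ρ ^ r * polarTheta p q r P Q φ ρ)

/-- The ring of germs at `a` of real analytic functions of the parameters, regarded as functions
on the parameter set `Λ`; if `Λ` is a neighbourhood of `a`, this is the usual ring of germs of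
analytic functions at `a`. -/
def analyticGerms {m : ℕ} (Λ : Set (EuclideanSpace ℝ (Fin m))) (a : EuclideanSpace ℝ (Fin m)) :
    Subring ((𝓝[Λ] a).Germ ℝ) where
  carrier := {g | ∃ f : EuclideanSpace ℝ (Fin m) → ℝ,
    AnalyticAt ℝ f a ∧ g = (f : (𝓝[Λ] a).Germ ℝ)}
  mul_mem' := by
    rintro _ _ ⟨f, hf, rfl⟩ ⟨g, hg, rfl⟩
    exact ⟨f * g, hf.mul hg, rfl⟩
  one_mem' := ⟨1, analyticAt_const, rfl⟩
  add_mem' := by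
    rintro _ _ ⟨f, hf, rfl⟩ ⟨g, hg, rfl⟩
    exact ⟨f + g, hf.add hg, rfl⟩
  zero_mem' := ⟨0, analyticAt_const, rfl⟩
  neg_mem' := by
    rintro _ ⟨f, hf, rfl⟩
    exact ⟨-f, hf.neg, rfl⟩

/-- `f ≡ g` modulo the ideal generated by (the germs of) the functions in `S`, in the ring of germs
of analytic functions at `a` on the parameter set `Λ`. -/
def GermCongr {m : ℕ} (Λ : Set (EuclideanSpace ℝ (Fin m))) (a : EuclideanSpace ℝ (Fin m))
    (S : Set (EuclideanSpace ℝ (Fin m) → ℝ)) (f g : EuclideanSpace ℝ (Fin m) → ℝ) : Prop :=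
  ∃ h : analyticGerms Λ a,
    (h : (𝓝[Λ] a).Germ ℝ) = ((f - g : EuclideanSpace ℝ (Fin m) → ℝ) : (𝓝[Λ] a).Germ ℝ) ∧
    h ∈ Ideal.span {u : analyticGerms Λ a |
      ∃ v ∈ S, (u : (𝓝[Λ] a).Germ ℝ) = (v : (𝓝[Λ] a).Germ ℝ)}

end MonodromicClass

end

open scoped ContDiff

set_option linter.unusedSectionVars false

/-! Along an orbit in weighted polar coordinates, `F' = K̂ F` with `'` the derivative in `φ`.
Integrating over one turn gives `∫ K̂ = log (F(Π^p, 0) / F(ρ₀^p, 0))`, so the cofactor enters only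
through the values of `F` on the positive horizontal axis. There `F(x^p, 0) = x^s g(x)` with `g(0) =
F_s(1, 0) ≠ 0`. Put `Π(x) = x (1 + Z(x))`; the Taylor coefficients of `Z` are `d₀ = η₁ - 1` and `d_i
= η_{i+1}`. The logarithm equals `s log (1 + Z) + log g(x + xZ) - log g(x)` (up to a common sign of
`g`), hence has the form `s Z + Z Y` with `Y` analytic and `Y = Z y` at `x = 0`. Comparing
coefficients, `β_i = s d_i + ∑_{j ≤ i} d_j c_{i-j}` with `c₀ = d₀ y`, and `β₀ = s log η₁`. This
gives the congruences modulo the lower `d_j`. If `K` starts at degree `r̄`, then `K̂ = O(x^{r̄-r})`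
along the solutions, so `β_i = 0` for `i < r̄ - r`, and the triangular relations, with `s > 0`,
force the corresponding `d_i` to vanish.

Analyticity up to `ρ = 0` rests on three points. A monodromic leading part has no characteristic
directions (`angular_ne_zero_of_isMonodromic`), so `Θ(φ, 0) ≠ 0`. The weighted blow-up acts
analytically on continuous functions of `φ` (`exists_blowup`, through the superposition operators of
`exists_analyticAt_superposition`). The substitution `ρ = x exp V` turns the polar equation into a
fixed point equation that is regular at `x = 0`, solved by the analytic implicit function theorem
(`exists_exp_solution`); it also shows `Π / x > 0`, whence `η₁ > 0`. The bounds `K_j = 0` for `j <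
r` and `F_s(1, 0) ≠ 0` follow by letting `x → 0` in `F' = K̂ F`.

Since `Λ` is an arbitrary set, the expansions need not start at the prescribed degrees for
parameters near `Λ` but outside it. Replacing `P`, `Q`, `F` by their `truncation` changes nothing on
`Λ` and keeps everything analytic on a full neighbourhood. The coefficients are defined once for all
parameters through `rightCoeff`; locally they agree with those of an analytic function
(`eventually_rightCoeff_eq`). -/

namespace MonodromicClass

/-! ### Superposition operators on spaces of continuous functions. -/

section Nemytskii

variable {T : Type*} [TopologicalSpace T] [CompactSpace T]
  {E : Type*} [NormedAddCommGroup E] [NormedSpace ℝ E]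
  {G : Type*} [NormedAddCommGroup G] [NormedSpace ℝ G]

/-- The pointwise lift of a continuous multilinear map to spaces of continuous functions. -/
noncomputable def liftMultilinear (n : ℕ) (p : E [×n]→L[ℝ] G) : C(T, E) [×n]→L[ℝ] C(T, G) :=
  MultilinearMap.mkContinuous
    { toFun := fun u => ⟨fun t => p fun i => u i t, by fun_prop⟩
      map_update_add' := by
        intro _ u i x y
        ext t
        have h : ∀ z : C(T, E), (fun j => (Function.update u i z) j t)
            = Function.update (fun j => u j t) i (z t) := by
          intro z; funext j
          by_cases hj : j = i
          · subst hj; simp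
          · simp [hj]
        convert p.map_update_add (fun j => u j t) i (x t) (y t) using 1 <;> simp [h]
      map_update_smul' := by
        intro _ u i c x
        ext t
        have h : ∀ z : C(T, E), (fun j => (Function.update u i z) j t)
            = Function.update (fun j => u j t) i (z t) := by
          intro z; funext j
          by_cases hj : j = i
          · subst hj; simp
          · simp [hj]
        convert p.map_update_smul (fun j => u j t) i c (x t) using 1 <;> simp [h] }
    ‖p‖ (by
      intro u
      rw [ContinuousMap.norm_le _ (by positivity)]
      intro t
      refine (p.le_opNorm _).trans ?_
      gcongr with i
      exact (u i).norm_coe_le_norm t)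

lemma norm_liftMultilinear_le (n : ℕ) (p : E [×n]→L[ℝ] G) :
    ‖(liftMultilinear n p : C(T, E) [×n]→L[ℝ] C(T, G))‖ ≤ ‖p‖ :=
  MultilinearMap.mkContinuous_norm_le _ (norm_nonneg _) _

/-- The superposition operator induced by an analytic function is analytic at constant
functions. -/
theorem exists_analyticAt_superposition [CompleteSpace G] {f : E → G} {z : E}
    (hf : AnalyticAt ℝ f z) :
    ∃ Φ : C(T, E) → C(T, G), AnalyticAt ℝ Φ (ContinuousMap.const T z) ∧
      ∀ᶠ u in 𝓝 (ContinuousMap.const T z), ∀ t, Φ u t = f (u t) := by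
  obtain ⟨p, r, hp⟩ := hf
  let P : FormalMultilinearSeries ℝ C(T, E) C(T, G) := fun n => liftMultilinear n (p n)
  -- Lifting does not increase the norm of any term, so the lifted series converges at least on the
  -- same ball.
  have hr : p.radius ≤ P.radius := by
    refine ENNReal.le_of_forall_nnreal_lt fun ρ hρ => ?_
    obtain ⟨C, -, hC⟩ := p.norm_mul_pow_le_of_lt_radius hρ
    refine P.le_radius_of_bound C fun n => (le_trans ?_ (hC n))
    gcongr
    exact norm_liftMultilinear_le n (p n)
  have hpos : 0 < P.radius := hp.r_pos.trans_le (hp.r_le.trans hr)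
  refine ⟨fun u => P.sum (u - ContinuousMap.const T z), ?_, ?_⟩
  · have h0 : AnalyticAt ℝ P.sum (ContinuousMap.const T z - ContinuousMap.const T z) := by
      rw [sub_self]; exact (P.hasFPowerSeriesOnBall hpos).analyticAt
    exact AnalyticAt.comp (f := fun u => u - ContinuousMap.const T z) h0
      (analyticAt_id.sub analyticAt_const)
  · have : Metric.eball (ContinuousMap.const T z) r ∈ 𝓝 (ContinuousMap.const T z) :=
      Metric.eball_mem_nhds _ hp.r_pos
    filter_upwards [this] with u hu t
    have hu' : u - ContinuousMap.const T z ∈ Metric.eball (0 : C(T, E)) r := by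
      rw [Metric.mem_eball, edist_eq_enorm_sub] at hu ⊢; simpa using hu
    have h1 : HasSum (fun n => P n fun _ => u - ContinuousMap.const T z)
        (P.sum (u - ContinuousMap.const T z)) :=
      P.hasSum (Metric.eball_subset_eball (hp.r_le.trans hr) hu')
    -- Evaluation at `t` is continuous and linear, so it carries the series of functions to the
    -- numerical series of `f` at `u t`.
    have h2 := h1.mapL (ContinuousMap.evalCLM ℝ t)
    have hut : u t - z ∈ Metric.eball (0 : E) r := by
      rw [Metric.mem_eball, edist_zero_right] at hu' ⊢
      refine lt_of_le_of_lt ?_ hu'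
      rw [← ofReal_norm, ← ofReal_norm]
      exact ENNReal.ofReal_le_ofReal ((u - ContinuousMap.const T z).norm_coe_le_norm t)
    have h3 := hp.hasSum hut
    rw [add_sub_cancel] at h3
    exact h2.unique h3

end Nemytskii

/-! ### The integration operator on continuous functions. -/

section Primitive

variable {τ : ℝ}

/-- The primitive, vanishing at `0`, of a continuous function on `[0, τ]`. -/
noncomputable def primitive (hτ : 0 ≤ τ) : C(Icc 0 τ, ℝ) →L[ℝ] C(Icc 0 τ, ℝ) :=
  LinearMap.mkContinuous
    { toFun := fun u => ⟨fun φ => ∫ t in (0 : ℝ)..φ, Set.IccExtend hτ u t, by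
        have hc : Continuous (Set.IccExtend hτ u) := u.continuous.Icc_extend'
        have := intervalIntegral.continuous_primitive (μ := MeasureTheory.volume)
          (fun a b => hc.intervalIntegrable a b) 0
        exact this.comp continuous_subtype_val⟩
      map_add' := by
        intro u v
        ext φ
        have hu : Continuous (Set.IccExtend hτ u) := u.continuous.Icc_extend'
        have hv : Continuous (Set.IccExtend hτ v) := v.continuous.Icc_extend'
        simp only [ContinuousMap.coe_mk, ContinuousMap.add_apply]
        rw [← intervalIntegral.integral_add (hu.intervalIntegrable _ _)
          (hv.intervalIntegrable _ _)]
        rfl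
      map_smul' := by
        intro c u
        ext φ
        simp only [ContinuousMap.coe_mk, ContinuousMap.smul_apply, RingHom.id_apply]
        rw [← intervalIntegral.integral_smul]
        rfl }
    τ (by
      intro u
      rw [ContinuousMap.norm_le _ (by positivity)]
      intro φ
      have h := intervalIntegral.norm_integral_le_of_norm_le_const (a := 0) (b := (φ : ℝ))
        (C := ‖u‖) (f := Set.IccExtend hτ u) fun t _ => u.norm_coe_le_norm _
      refine h.trans ?_
      rw [sub_zero, abs_of_nonneg φ.2.1, mul_comm]
      gcongr
      exact φ.2.2)

lemma primitive_apply (hτ : 0 ≤ τ) (u : C(Icc 0 τ, ℝ)) (φ : Icc 0 τ) :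
    primitive hτ u φ = ∫ t in (0 : ℝ)..φ, Set.IccExtend hτ u t := rfl

lemma primitive_zero (hτ : 0 ≤ τ) (u : C(Icc 0 τ, ℝ)) :
    primitive hτ u ⟨0, left_mem_Icc.2 hτ⟩ = 0 := by simp [primitive_apply]

lemma hasDerivWithinAt_iccExtend_primitive (hτ : 0 ≤ τ) (u : C(Icc 0 τ, ℝ)) (φ : Icc 0 τ) :
    HasDerivWithinAt (Set.IccExtend hτ (primitive hτ u)) (u φ) (Icc 0 τ) φ := by
  have hc : Continuous (Set.IccExtend hτ u) := u.continuous.Icc_extend'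
  have h := (hc.integral_hasStrictDerivAt 0 (φ : ℝ)).hasDerivAt.hasDerivWithinAt (s := Icc 0 τ)
  rw [Set.IccExtend_val] at h
  refine h.congr (fun t ht => ?_) ?_
  · rw [Set.IccExtend_of_mem _ _ ht]; rfl
  · rw [Set.IccExtend_val]; rfl

lemma eq_zero_of_primitive_eq_zero (hτ : 0 < τ) {u : C(Icc 0 τ, ℝ)}
    (h : primitive hτ.le u = 0) : u = 0 := by
  ext φ
  have h1 := hasDerivWithinAt_iccExtend_primitive hτ.le u φ
  have h2 : HasDerivWithinAt (Set.IccExtend hτ.le (primitive hτ.le u)) 0 (Icc 0 τ) φ := by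
    rw [h]
    have : Set.IccExtend hτ.le ((0 : C(Icc 0 τ, ℝ)) : Icc 0 τ → ℝ) = fun _ => (0 : ℝ) := by
      funext t; simp [Set.IccExtend]
    rw [this]; exact hasDerivWithinAt_const _ _ _
  exact (uniqueDiffOn_Icc hτ _ φ.2).eq_deriv _ h1 h2

end Primitive

/-! ### Taylor coefficients in one variable, depending on parameters. -/

section Coefficients

variable {E : Type*} [NormedAddCommGroup E] [NormedSpace ℝ E]

/-- Division with remainder of an analytic function by its first variable. -/
theorem exists_analyticAt_eq_add_mul {f : ℝ × E → ℝ} {e : E} (hf : AnalyticAt ℝ f (0, e)) :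
    ∃ g : ℝ × E → ℝ, AnalyticAt ℝ g (0, e) ∧ ∀ᶠ z in 𝓝 ((0 : ℝ), e), f z = f (0, z.2) + z.1 * g z := by
  -- Hadamard's formula: the quotient is `∫₀¹ ∂₁f(t x, b) dt`. It is analytic because the segment `t
  -- ↦ (t x, b)` depends linearly on `(x, b)` as a continuous function, and superposition and
  -- integration are analytic.
  have hd : AnalyticAt ℝ (fun z => fderiv ℝ f z (1, 0)) (0, e) :=
    ((ContinuousLinearMap.apply ℝ ℝ ((1 : ℝ), (0 : E))).analyticAt _).comp hf.fderiv
  obtain ⟨Φ, hΦ, hΦe⟩ := exists_analyticAt_superposition (T := Icc (0 : ℝ) 1) hd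
  let ι : ℝ × E →L[ℝ] C(Icc (0 : ℝ) 1, ℝ × E) :=
    LinearMap.mkContinuous
      { toFun := fun z => ⟨fun t => ((t : ℝ) * z.1, z.2), by fun_prop⟩
        map_add' := by intro z w; ext t <;> simp [mul_add]
        map_smul' := by intro c z; ext t <;> simp; ring }
      1 (by
        intro z
        rw [ContinuousMap.norm_le _ (by positivity)]
        intro t
        simp only [LinearMap.coe_mk, AddHom.coe_mk, ContinuousMap.coe_mk, one_mul, Prod.norm_def]
        refine max_le_max ?_ le_rfl
        rw [norm_mul]
        have : ‖(t : ℝ)‖ ≤ 1 := by rw [Real.norm_of_nonneg t.2.1]; exact t.2.2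
        nlinarith [norm_nonneg z.1])
  have hιt : ∀ z t, ι z t = ((t : ℝ) * z.1, z.2) := fun z t => rfl
  have hι0 : ι (0, e) = ContinuousMap.const _ (0, e) := by
    ext t <;> simp [hιt]
  have hι : ContinuousAt ι (0, e) := ι.continuous.continuousAt
  rw [← hι0] at hΦ hΦe
  refine ⟨fun z => primitive zero_le_one (Φ (ι z)) ⟨1, right_mem_Icc.2 zero_le_one⟩, ?_, ?_⟩
  · have h1 : AnalyticAt ℝ (fun z => Φ (ι z)) (0, e) := hΦ.comp (ι.analyticAt _)
    exact (((ContinuousMap.evalCLM ℝ _).comp (primitive zero_le_one)).analyticAt _).comp h1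
  · have hball : ∀ᶠ z in 𝓝 ((0 : ℝ), e), ∀ t ∈ Icc (0 : ℝ) 1, AnalyticAt ℝ f (t * z.1, z.2) := by
      obtain ⟨ε, hε, h⟩ := Metric.eventually_nhds_iff_ball.1 hf.eventually_analyticAt
      filter_upwards [Metric.ball_mem_nhds _ hε] with z hz t ht
      refine h _ ?_
      rw [mem_ball_iff_norm, Prod.norm_def] at hz ⊢
      refine lt_of_le_of_lt (max_le_max ?_ le_rfl) hz
      simp only [Prod.fst_sub, sub_zero, norm_mul]
      have : ‖t‖ ≤ 1 := by rw [Real.norm_of_nonneg ht.1]; exact ht.2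
      nlinarith [norm_nonneg z.1]
    filter_upwards [hι.eventually hΦe, hball] with z hz hz'
    rw [primitive_apply]
    have h1 : ∀ t ∈ uIcc (0 : ℝ) 1, HasDerivAt (fun t : ℝ => f (t * z.1, z.2))
        (z.1 * Set.IccExtend zero_le_one (Φ (ι z)) t) t := by
      intro t ht
      rw [uIcc_of_le zero_le_one] at ht
      have h2 := (hz' t ht).differentiableAt.hasFDerivAt.comp_hasDerivAt t
        (((hasDerivAt_id t).mul_const z.1).prodMk (hasDerivAt_const t z.2))
      rw [Set.IccExtend_of_mem _ _ ht, hz, hιt]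
      have h4 : ((1 * z.1, (0 : E)) : ℝ × E) = z.1 • (1, 0) := by simp
      rw [h4, map_smul, smul_eq_mul] at h2
      exact h2
    have hc : Continuous (Set.IccExtend zero_le_one (Φ (ι z))) := (Φ (ι z)).continuous.Icc_extend'
    have h3 := intervalIntegral.integral_eq_sub_of_hasDerivAt h1
      ((continuous_const.mul hc).intervalIntegrable _ _)
    rw [intervalIntegral.integral_const_mul] at h3
    simp only [one_mul, zero_mul] at h3
    linarith

/-- The Taylor coefficient at `0` of order `i` with respect to the first variable. -/
noncomputable def parCoeff (i : ℕ) (f : ℝ × E → ℝ) (b : E) : ℝ :=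
  iteratedDeriv i (fun x => f (x, b)) 0 / (i.factorial : ℝ)

lemma parCoeff_zero (f : ℝ × E → ℝ) (b : E) : parCoeff 0 f b = f (0, b) := by
  simp [parCoeff]

lemma _root_.AnalyticAt.fst_slice {f : ℝ × E → ℝ} {x : ℝ} {b : E} (hf : AnalyticAt ℝ f (x, b)) :
    AnalyticAt ℝ (fun x => f (x, b)) x :=
  AnalyticAt.comp (g := f) (f := fun x => (x, b)) hf (analyticAt_id.prod analyticAt_const)

lemma parCoeff_congr {f g : ℝ × E → ℝ} {b : E} (h : ∀ᶠ x in 𝓝 (0 : ℝ), f (x, b) = g (x, b))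
    (i : ℕ) : parCoeff i f b = parCoeff i g b := by
  unfold parCoeff
  rw [Filter.EventuallyEq.iteratedDeriv_eq i h]

/-- The parameter is quantified first: each nearby parameter keeps its own neighbourhood of `x = 0`,
which suffices for Taylor coefficients in `x`. -/
lemma eventually_slice {p : ℝ × E → Prop} {b : E} (h : ∀ᶠ z in 𝓝 ((0 : ℝ), b), p z) :
    ∀ᶠ c in 𝓝 b, ∀ᶠ x in 𝓝 (0 : ℝ), p (x, c) := by
  have : Tendsto (fun z : E × ℝ => (z.2, z.1)) (𝓝 (b, 0)) (𝓝 (0, b)) :=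
    (continuous_snd.prodMk continuous_fst).tendsto' _ _ rfl
  exact (this.eventually h).curry_nhds

lemma parCoeff_add {f g : ℝ × E → ℝ} {b : E} (hf : AnalyticAt ℝ f (0, b))
    (hg : AnalyticAt ℝ g (0, b)) (i : ℕ) :
    parCoeff i (fun z => f z + g z) b = parCoeff i f b + parCoeff i g b := by
  unfold parCoeff
  rw [iteratedDeriv_fun_add hf.fst_slice.contDiffAt hg.fst_slice.contDiffAt, add_div]

lemma parCoeff_const_mul {f : ℝ × E → ℝ} {b : E} (c : ℝ) (i : ℕ) :
    parCoeff i (fun z => c * f z) b = c * parCoeff i f b := by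
  unfold parCoeff
  rw [iteratedDeriv_const_mul_field, mul_div_assoc]

lemma parCoeff_mul {f g : ℝ × E → ℝ} {b : E} (hf : AnalyticAt ℝ f (0, b))
    (hg : AnalyticAt ℝ g (0, b)) (i : ℕ) :
    parCoeff i (fun z => f z * g z) b
      = ∑ j ∈ Finset.range (i + 1), parCoeff j f b * parCoeff (i - j) g b := by
  unfold parCoeff
  rw [iteratedDeriv_fun_mul hf.fst_slice.contDiffAt hg.fst_slice.contDiffAt, Finset.sum_div]
  refine Finset.sum_congr rfl fun j hj => ?_
  have hj' : j ≤ i := Nat.lt_succ_iff.1 (Finset.mem_range.1 hj)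
  rw [Nat.cast_choose ℝ hj']
  have h1 : (i.factorial : ℝ) ≠ 0 := by positivity
  have h2 : (j.factorial : ℝ) ≠ 0 := by positivity
  have h3 : ((i - j).factorial : ℝ) ≠ 0 := by positivity
  field_simp

lemma parCoeff_fst (i : ℕ) (b : E) :
    parCoeff i (fun z : ℝ × E => z.1) b = if i = 1 then 1 else 0 := by
  unfold parCoeff
  rcases i with _ | _ | i
  · simp
  · simp
  · simp [iteratedDeriv_fun_id]

lemma parCoeff_succ_fst_mul {f : ℝ × E → ℝ} {b : E} (hf : AnalyticAt ℝ f (0, b)) (i : ℕ) :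
    parCoeff (i + 1) (fun z => z.1 * f z) b = parCoeff i f b := by
  rw [parCoeff_mul analyticAt_fst hf, Finset.sum_eq_single 1]
  · simp [parCoeff_fst]
  · intro j _ hj; simp [parCoeff_fst, hj]
  · intro h; exact absurd (Finset.mem_range.2 (by omega)) h

lemma parCoeff_snd_add {f : ℝ × E → ℝ} {b : E} (c : ℝ) (i : ℕ) :
    parCoeff (i + 1) (fun z => c + f z) b = parCoeff (i + 1) f b := by
  unfold parCoeff
  rw [iteratedDeriv_const_add (Nat.succ_pos i)]

lemma parCoeff_succ_of_eq {f g : ℝ × E → ℝ} {e : E} (hg : AnalyticAt ℝ g (0, e))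
    (h : ∀ᶠ z in 𝓝 ((0 : ℝ), e), f z = f (0, z.2) + z.1 * g z) (i : ℕ) :
    ∀ᶠ b in 𝓝 e, parCoeff (i + 1) f b = parCoeff i g b := by
  filter_upwards [eventually_slice h, eventually_slice hg.eventually_analyticAt] with b hb hgb
  rw [← parCoeff_succ_fst_mul hgb.self_of_nhds i,
    ← parCoeff_snd_add (f := fun z => z.1 * g z) (f (0, b)) i]
  exact parCoeff_congr hb _

/-- Division by the first variable lowers the index by one, so induction reduces every coefficient
to a restriction to `x = 0`. -/
theorem analyticAt_parCoeff {f : ℝ × E → ℝ} {e : E} (hf : AnalyticAt ℝ f (0, e)) (i : ℕ) :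
    AnalyticAt ℝ (parCoeff i f) e := by
  induction i generalizing f with
  | zero =>
    have : parCoeff 0 f = fun b => f (0, b) := funext fun b => parCoeff_zero f b
    rw [this]
    exact AnalyticAt.comp (g := f) (f := fun b => ((0 : ℝ), b)) hf
      (analyticAt_const.prod analyticAt_id)
  | succ i ih =>
    obtain ⟨g, hg, h⟩ := exists_analyticAt_eq_add_mul hf
    exact (ih hg).congr ((parCoeff_succ_of_eq hg h i).mono fun _ hb => hb.symm)

/-- Taylor expansion with respect to the first variable. -/
theorem exists_taylor_remainder {f : ℝ × E → ℝ} {e : E} (hf : AnalyticAt ℝ f (0, e)) (N : ℕ) :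
    ∃ g : ℝ × E → ℝ, AnalyticAt ℝ g (0, e) ∧ ∀ᶠ z in 𝓝 ((0 : ℝ), e),
      f z = ∑ j ∈ Finset.range N, z.1 ^ j * parCoeff j f z.2 + z.1 ^ N * g z := by
  induction N generalizing f with
  | zero => exact ⟨f, hf, by simp⟩
  | succ N ih =>
    obtain ⟨g, hg, h⟩ := exists_analyticAt_eq_add_mul hf
    obtain ⟨k, hk, h'⟩ := ih hg
    refine ⟨k, hk, ?_⟩
    have h3 : ∀ᶠ b in 𝓝 e, ∀ j ∈ Finset.range N, parCoeff (j + 1) f b = parCoeff j g b :=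
      (Filter.eventually_all_finset _).2 fun j _ => parCoeff_succ_of_eq hg h j
    filter_upwards [h, h', continuousAt_snd.eventually h3] with z h1 h2 h3
    rw [h1, h2, Finset.sum_range_succ', parCoeff_zero, mul_add, Finset.mul_sum]
    have h4 : ∀ j ∈ Finset.range N, z.1 * (z.1 ^ j * parCoeff j g z.2)
        = z.1 ^ (j + 1) * parCoeff (j + 1) f z.2 := fun j hj => by rw [h3 j hj]; ring
    rw [Finset.sum_congr rfl h4]
    ring

lemma hasSum_parCoeff {f : ℝ × E → ℝ} {b : E} (hf : AnalyticAt ℝ f (0, b)) :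
    ∀ᶠ x in 𝓝 (0 : ℝ), HasSum (fun i => parCoeff i f b * x ^ i) (f (x, b)) := by
  have h := hf.fst_slice.hasFPowerSeriesAt.eventually_hasSum
  filter_upwards [h] with x hx
  rw [zero_add] at hx
  simpa [parCoeff, FormalMultilinearSeries.coeff_ofScalars, mul_comm] using hx

/-- The Taylor coefficient of a germ at the right of `0` which extends analytically to `0`. -/
noncomputable def rightCoeff (f : ℝ → ℝ) (i : ℕ) : ℝ :=
  open Classical in
  if h : ∃ g : ℝ → ℝ, AnalyticAt ℝ g 0 ∧ f =ᶠ[𝓝[>] 0] g then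
    iteratedDeriv i h.choose 0 / (i.factorial : ℝ) else 0

/-- Identity theorem: points to the right of `0` already accumulate at `0`. This makes `rightCoeff`
independent of the chosen extension. -/
lemma eventuallyEq_of_nhdsGT {f g : ℝ → ℝ} (hf : AnalyticAt ℝ f 0) (hg : AnalyticAt ℝ g 0)
    (h : f =ᶠ[𝓝[>] 0] g) : f =ᶠ[𝓝 0] g := by
  refine (hf.frequently_eq_iff_eventually_eq hg).1 ?_
  exact h.frequently.filter_mono (nhdsWithin_mono _ fun x hx => ne_of_gt hx)

lemma rightCoeff_eq {f g : ℝ → ℝ} (hg : AnalyticAt ℝ g 0) (h : f =ᶠ[𝓝[>] 0] g) (i : ℕ) :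
    rightCoeff f i = iteratedDeriv i g 0 / (i.factorial : ℝ) := by
  have hex : ∃ g : ℝ → ℝ, AnalyticAt ℝ g 0 ∧ f =ᶠ[𝓝[>] 0] g := ⟨g, hg, h⟩
  rw [rightCoeff, dif_pos hex]
  have := eventuallyEq_of_nhdsGT hex.choose_spec.1 hg (hex.choose_spec.2.symm.trans h)
  rw [this.iteratedDeriv_eq]

end Coefficients

/-! ### Weighted blow-up of analytic families. -/

section Blowup

/-- The function `f` without its quasihomogeneous components of degree smaller than `n`. -/
noncomputable def truncation (p q n : ℕ) (f : ℝ → ℝ → ℝ) (x y : ℝ) : ℝ :=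
  f x y - ∑ k ∈ Finset.range n, qhPart p q f k x y

lemma truncation_of_startsAt {p q n : ℕ} {f : ℝ → ℝ → ℝ} (h : StartsAt p q f n) :
    truncation p q n f = f := by
  funext x y
  rw [truncation, Finset.sum_eq_zero fun k hk => h k (Finset.mem_range.1 hk) x y, sub_zero]

lemma qhPart_eq_sum {p q : ℕ} (hp : 0 < p) (hq : 0 < q) (f : ℝ → ℝ → ℝ) {k N : ℕ} (hk : k < N)
    (x y : ℝ) :
    qhPart p q f k x y = ∑ ab ∈ Finset.range N ×ˢ Finset.range N,
      if k = p * ab.1 + q * ab.2 then taylorCoeff f ab.1 ab.2 * x ^ ab.1 * y ^ ab.2 else 0 := by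
  rw [qhPart, ← Finset.sum_filter]
  refine Finset.sum_congr ?_ fun _ _ => rfl
  ext ⟨i, j⟩
  simp only [Finset.mem_filter, Finset.mem_product, Finset.mem_range]
  constructor
  · rintro ⟨⟨h1, h2⟩, h3⟩
    exact ⟨⟨by omega, by omega⟩, h3.symm⟩
  · rintro ⟨⟨h1, h2⟩, h3⟩
    have h4 : i ≤ p * i := Nat.le_mul_of_pos_left _ hp
    have h5 : j ≤ q * j := Nat.le_mul_of_pos_left _ hq
    exact ⟨⟨by omega, by omega⟩, h3.symm⟩

lemma sum_qhPart_eq {p q : ℕ} (hp : 0 < p) (hq : 0 < q) (f : ℝ → ℝ → ℝ) {n N : ℕ} (hn : n ≤ N)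
    (x y : ℝ) :
    ∑ k ∈ Finset.range n, qhPart p q f k x y = ∑ ab ∈ Finset.range N ×ˢ Finset.range N,
      if p * ab.1 + q * ab.2 < n then taylorCoeff f ab.1 ab.2 * x ^ ab.1 * y ^ ab.2 else 0 := by
  rw [Finset.sum_congr rfl fun k hk =>
    qhPart_eq_sum hp hq f ((Finset.mem_range.1 hk).trans_le hn) x y, Finset.sum_comm]
  refine Finset.sum_congr rfl fun ab _ => ?_
  rw [Finset.sum_ite_eq']
  simp

variable {E : Type*} [NormedAddCommGroup E] [NormedSpace ℝ E]

/-- Taylor expansion in two variables, with parameters. -/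
theorem exists_taylor_remainder_two {f : E → ℝ → ℝ → ℝ} {a : E}
    (hf : AnalyticAt ℝ (fun z : ℝ × ℝ × E => f z.2.2 z.1 z.2.1) (0, 0, a)) (N : ℕ) :
    (∀ i j, AnalyticAt ℝ (fun b => taylorCoeff (f b) i j) a) ∧
    ∃ (g : ℝ × ℝ × E → ℝ) (k : ℕ → ℝ × ℝ × E → ℝ), AnalyticAt ℝ g (0, 0, a) ∧
      (∀ j, AnalyticAt ℝ (k j) (0, 0, a)) ∧ ∀ᶠ z in 𝓝 ((0 : ℝ), (0 : ℝ), a),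
        f z.2.2 z.1 z.2.1 = ∑ ab ∈ Finset.range N ×ˢ Finset.range N,
            taylorCoeff (f z.2.2) ab.1 ab.2 * z.1 ^ ab.1 * z.2.1 ^ ab.2
          + ∑ j ∈ Finset.range N, z.2.1 ^ j * z.1 ^ N * k j z + z.2.1 ^ N * g z := by
  -- Expansions are taken in the first variable. `σ` moves `y` to the front for the first one; its
  -- coefficients no longer depend on `y`, and `τ` discards it before they are expanded in `x`.
  let σ : ℝ × ℝ × E →L[ℝ] ℝ × ℝ × E :=
    ((ContinuousLinearMap.fst ℝ ℝ E).comp (.snd ℝ ℝ (ℝ × E))).prod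
      ((ContinuousLinearMap.fst ℝ ℝ (ℝ × E)).prod
        ((ContinuousLinearMap.snd ℝ ℝ E).comp (.snd ℝ ℝ (ℝ × E))))
  have hσ : ∀ z, σ z = (z.2.1, z.1, z.2.2) := fun z => rfl
  let τ : ℝ × ℝ × E →L[ℝ] ℝ × E :=
    (ContinuousLinearMap.fst ℝ ℝ (ℝ × E)).prod
        ((ContinuousLinearMap.snd ℝ ℝ E).comp (.snd ℝ ℝ (ℝ × E)))
  have hτ : ∀ z, τ z = (z.1, z.2.2) := fun z => rfl
  let F : ℝ × ℝ × E → ℝ := fun w => f w.2.2 w.2.1 w.1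
  have hF : AnalyticAt ℝ F (0, 0, a) :=
    AnalyticAt.comp (g := fun z : ℝ × ℝ × E => f z.2.2 z.1 z.2.1) (f := σ) hf (σ.analyticAt _)
  have hcoef : ∀ i j b, parCoeff i (parCoeff j F) b = taylorCoeff (f b) i j := by
    intro i j b
    unfold parCoeff taylorCoeff
    rw [iteratedDeriv_div_const, div_div, mul_comm]
  obtain ⟨g, hg, hgF⟩ := exists_taylor_remainder hF N
  have hh : ∀ j, AnalyticAt ℝ (parCoeff j F) (0, a) := fun j => analyticAt_parCoeff hF j
  choose k hk hkF using fun j => exists_taylor_remainder (hh j) N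
  refine ⟨fun i j => ?_, fun z => g (σ z), fun j z => k j (τ z), ?_, fun j => ?_, ?_⟩
  · exact (analyticAt_parCoeff (hh j) i).congr (Eventually.of_forall fun b => hcoef i j b)
  · exact AnalyticAt.comp (f := σ) hg (σ.analyticAt _)
  · exact AnalyticAt.comp (f := τ) (hk j) (τ.analyticAt _)
  · have h1 : ∀ᶠ w in 𝓝 ((0 : ℝ), a), ∀ j ∈ Finset.range N, parCoeff j F w =
        ∑ i ∈ Finset.range N, w.1 ^ i * parCoeff i (parCoeff j F) w.2 + w.1 ^ N * k j w :=
      (Filter.eventually_all_finset _).2 fun j _ => hkF j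
    filter_upwards [(σ.continuous.tendsto' (0, 0, a) (0, 0, a) rfl).eventually hgF,
      (τ.continuous.tendsto' (0, 0, a) (0, a) rfl).eventually h1] with z hz1 hz2
    have hz3 : f z.2.2 z.1 z.2.1 = F (σ z) := rfl
    rw [hz3, hz1]
    congr 1
    simp only [hσ] 
    simp only [hτ] at hz2
    rw [Finset.sum_product_right, ← Finset.sum_add_distrib]
    refine Finset.sum_congr rfl fun j hj => ?_
    rw [hz2 j hj, mul_add, Finset.mul_sum]
    congr 1
    · refine Finset.sum_congr rfl fun i _ => ?_
      rw [hcoef]; ring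
    · simp only [hτ]; ring

variable {T : Type*} [TopologicalSpace T] [CompactSpace T]

lemma eventually_forall_apply {X : Type*} [NormedAddCommGroup X] {p : X → Prop} {x : X}
    (h : ∀ᶠ y in 𝓝 x, p y) : ∀ᶠ u in 𝓝 (ContinuousMap.const T x), ∀ t, p (u t) := by
  obtain ⟨ε, hε, h⟩ := Metric.eventually_nhds_iff_ball.1 h
  filter_upwards [Metric.ball_mem_nhds _ hε] with u hu t
  refine h _ ?_
  rw [mem_ball_iff_norm] at hu ⊢
  exact ((u - ContinuousMap.const T x).norm_coe_le_norm t).trans_lt hu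

/-- Pairing of two continuous functions and a constant. -/
noncomputable def pairConst (T : Type*) [TopologicalSpace T] [CompactSpace T]
    (E : Type*) [NormedAddCommGroup E] [NormedSpace ℝ E] :
    C(T, ℝ) × C(T, ℝ) × E →L[ℝ] C(T, ℝ × ℝ × E) :=
  LinearMap.mkContinuous
    { toFun := fun z => ⟨fun t => (z.1 t, z.2.1 t, z.2.2), by fun_prop⟩
      map_add' := by intro z w; ext t <;> simp
      map_smul' := by intro c z; ext t <;> simp }
    1 (by
      intro z
      rw [ContinuousMap.norm_le _ (by positivity)]
      intro t
      simp only [LinearMap.coe_mk, AddHom.coe_mk, ContinuousMap.coe_mk, one_mul, Prod.norm_def]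
      exact max_le_max (z.1.norm_coe_le_norm t) (max_le_max (z.2.1.norm_coe_le_norm t) le_rfl))

lemma pairConst_apply (z : C(T, ℝ) × C(T, ℝ) × E) (t : T) :
    pairConst T E z t = (z.1 t, z.2.1 t, z.2.2) := rfl

/-- After the quasihomogeneous substitution `x = u ^ p c`, `y = u ^ q s`, a function without
components of degree smaller than `n` is divisible by `u ^ n`, and the quotient depends
analytically on `u`, as an element of a space of continuous functions, and on the parameters. -/
theorem exists_blowup {p q : ℕ} (hp : 0 < p) (hq : 0 < q) (n : ℕ) {f : E → ℝ → ℝ → ℝ} {a : E}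
    (hf : AnalyticAt ℝ (fun z : ℝ × ℝ × E => f z.2.2 z.1 z.2.1) (0, 0, a)) (c s : C(T, ℝ)) :
    ∃ Φ : C(T, ℝ) × E → C(T, ℝ), AnalyticAt ℝ Φ (0, a) ∧
      (∀ b t, Φ (0, b) t = qhPart p q (f b) n (c t) (s t)) ∧
      ∀ᶠ z in 𝓝 ((0 : C(T, ℝ)), a), ∀ t,
        truncation p q n (f z.2) (z.1 t ^ p * c t) (z.1 t ^ q * s t) = z.1 t ^ n * Φ z t := by
  -- Order `n + 1` in each variable is enough: as `p, q ≥ 1`, both remainders have weighted degree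
  -- larger than `n`, so after division by `u ^ n` they keep a positive power of `u` and vanish at
  -- `u = 0`.
  obtain ⟨hco, g, k, hg, hk, hfe⟩ := exists_taylor_remainder_two hf (n + 1)
  let ι : C(T, ℝ) × E → C(T, ℝ × ℝ × E) :=
    fun z => pairConst T E (z.1 ^ p * c, z.1 ^ q * s, z.2)
  have hι0 : ι (0, a) = ContinuousMap.const T (0, 0, a) := by
    ext t <;> simp [ι, pairConst_apply, hp.ne', hq.ne']
  have hιa : AnalyticAt ℝ ι (0, a) := by
    refine ((pairConst T E).analyticAt _).comp ?_
    exact ((analyticAt_fst.pow p).mul analyticAt_const).prod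
      (((analyticAt_fst.pow q).mul analyticAt_const).prod analyticAt_snd)
  obtain ⟨G, hG, hGe⟩ := exists_analyticAt_superposition (T := T) hg
  choose K hK hKe using fun j => exists_analyticAt_superposition (T := T) (hk j)
  rw [← hι0] at hG hGe
  simp only [← hι0] at hK hKe
  have hfι : ∀ᶠ z in 𝓝 ((0 : C(T, ℝ)), a), ∀ t, (fun w : ℝ × ℝ × E =>
      f w.2.2 w.1 w.2.1 = ∑ ab ∈ Finset.range (n + 1) ×ˢ Finset.range (n + 1),
            taylorCoeff (f w.2.2) ab.1 ab.2 * w.1 ^ ab.1 * w.2.1 ^ ab.2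
          + ∑ j ∈ Finset.range (n + 1), w.2.1 ^ j * w.1 ^ (n + 1) * k j w
          + w.2.1 ^ (n + 1) * g w) (ι z t) := by
    have h := eventually_forall_apply (T := T) hfe
    rw [← hι0] at h
    exact hιa.continuousAt.eventually h
  have hKι : ∀ᶠ z in 𝓝 ((0 : C(T, ℝ)), a), ∀ j ∈ Finset.range (n + 1), ∀ t,
      K j (ι z) t = k j (ι z t) :=
    (Filter.eventually_all_finset _).2 fun j _ => hιa.continuousAt.eventually (hKe j)
  let I := Finset.range (n + 1) ×ˢ Finset.range (n + 1)
  let Φ : C(T, ℝ) × E → C(T, ℝ) := fun z =>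
    ∑ ab ∈ I.filter (fun ab : ℕ × ℕ => n ≤ p * ab.1 + q * ab.2),
        taylorCoeff (f z.2) ab.1 ab.2 • (c ^ ab.1 * s ^ ab.2 * z.1 ^ (p * ab.1 + q * ab.2 - n))
      + ∑ j ∈ Finset.range (n + 1),
        s ^ j * c ^ (n + 1) * z.1 ^ (q * j + p * (n + 1) - n) * K j (ι z)
      + s ^ (n + 1) * z.1 ^ (q * (n + 1) - n) * G (ι z)
  have hpn : n < p * (n + 1) := by nlinarith
  have hqn : n < q * (n + 1) := by nlinarith
  refine ⟨Φ, ?_, ?_, ?_⟩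
  · refine (AnalyticAt.add ?_ ?_).add ?_
    · refine Finset.analyticAt_fun_sum _ fun ab _ => ?_
      refine AnalyticAt.fun_smul ?_ (analyticAt_const.mul (analyticAt_fst.pow _))
      exact AnalyticAt.comp (g := fun b => taylorCoeff (f b) ab.1 ab.2) (hco _ _) analyticAt_snd
    · refine Finset.analyticAt_fun_sum _ fun j _ => ?_
      exact (analyticAt_const.mul (analyticAt_fst.pow _)).mul ((hK j).comp hιa)
    · exact (analyticAt_const.mul (analyticAt_fst.pow _)).mul (hG.comp hιa)
  · intro b t
    have h1 : q * (n + 1) - n ≠ 0 := by omega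
    have h2 : ∀ j, q * j + p * (n + 1) - n ≠ 0 := fun j => by omega
    simp only [Φ, ContinuousMap.coe_sum, Finset.sum_apply,
      ContinuousMap.mul_apply, ContinuousMap.smul_apply, ContinuousMap.pow_apply,
      ContinuousMap.zero_apply, zero_pow h1, zero_pow (h2 _), mul_zero, zero_mul, smul_eq_mul,
      Finset.sum_const_zero, add_zero]
    rw [qhPart_eq_sum hp hq _ (Nat.lt_succ_self n), Finset.sum_filter]
    refine Finset.sum_congr rfl fun ab _ => ?_
    rcases lt_trichotomy n (p * ab.1 + q * ab.2) with h | h | h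
    · rw [if_pos h.le, if_neg h.ne, zero_pow (by omega)]; ring
    · rw [if_pos h.le, if_pos h, ← h]; simp; ring
    · rw [if_neg (by omega), if_neg h.ne']
  · filter_upwards [hfι, hKι, hιa.continuousAt.eventually hGe] with z h1 h2 h3 t
    have h4 := h1 t
    have hιz : ι z t = (z.1 t ^ p * c t, z.1 t ^ q * s t, z.2) := rfl
    have h3' := h3 t
    have h2' := fun j hj => h2 j hj t
    simp only [hιz] at h4 h3' h2'
    rw [truncation, h4, sum_qhPart_eq hp hq (f z.2) (Nat.le_succ n)]
    simp only [Φ, ContinuousMap.add_apply, ContinuousMap.coe_sum, Finset.sum_apply,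
      ContinuousMap.mul_apply, ContinuousMap.smul_apply, ContinuousMap.pow_apply, smul_eq_mul]
    rw [mul_add, mul_add, Finset.mul_sum, Finset.mul_sum, add_assoc, add_sub_right_comm,
      ← Finset.sum_sub_distrib, add_assoc, h3']
    congr 1
    · rw [Finset.sum_filter]
      refine Finset.sum_congr rfl fun ab _ => ?_
      by_cases h : n ≤ p * ab.1 + q * ab.2
      · rw [if_pos h, if_neg (by omega)]
        obtain ⟨d, hd⟩ := Nat.exists_eq_add_of_le h
        rw [hd, Nat.add_sub_cancel_left, mul_pow, mul_pow, ← pow_mul, ← pow_mul]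
        have h5 : z.1 t ^ (p * ab.1) * z.1 t ^ (q * ab.2) = z.1 t ^ n * z.1 t ^ d := by
          rw [← pow_add, ← pow_add, hd]
        linear_combination (taylorCoeff (f z.2) ab.1 ab.2 * c t ^ ab.1 * s t ^ ab.2) * h5
      · rw [if_neg h, if_pos (by omega)]; ring
    · congr 1
      · refine Finset.sum_congr rfl fun j hj => ?_
        rw [h2' j hj, mul_pow, mul_pow, ← pow_mul, ← pow_mul]
        obtain ⟨d, hd⟩ := Nat.exists_eq_add_of_le (show n ≤ q * j + p * (n + 1) by omega)
        rw [hd, Nat.add_sub_cancel_left]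
        have h5 : z.1 t ^ (q * j) * z.1 t ^ (p * (n + 1)) = z.1 t ^ n * z.1 t ^ d := by
          rw [← pow_add, ← pow_add, hd]
        linear_combination (s t ^ j * c t ^ (n + 1) *
          k j (z.1 t ^ p * c t, z.1 t ^ q * s t, z.2)) * h5
      · rw [mul_pow, ← pow_mul]
        obtain ⟨d, hd⟩ := Nat.exists_eq_add_of_le hqn.le
        rw [hd, Nat.add_sub_cancel_left, pow_add]
        ring

end Blowup

/-! ### Absence of characteristic directions for a monodromic leading part. -/

section Leading

lemma qhPart_homogeneous (p q : ℕ) (f : ℝ → ℝ → ℝ) (j : ℕ) (τ x y : ℝ) :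
    qhPart p q f j (τ ^ p * x) (τ ^ q * y) = τ ^ j * qhPart p q f j x y := by
  unfold qhPart
  rw [Finset.mul_sum]
  refine Finset.sum_congr rfl fun ab hab => ?_
  rw [← (Finset.mem_filter.1 hab).2, mul_pow, mul_pow, ← pow_mul, ← pow_mul, pow_add]
  ring

lemma analyticAt_qhPart (p q : ℕ) (f : ℝ → ℝ → ℝ) (j : ℕ) (z : ℝ × ℝ) :
    AnalyticAt ℝ (fun z : ℝ × ℝ => qhPart p q f j z.1 z.2) z := by
  unfold qhPart
  refine Finset.analyticAt_fun_sum _ fun ab _ => ?_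
  exact (analyticAt_const.mul (analyticAt_fst.pow _)).mul (analyticAt_snd.pow _)

lemma _root_.HasDerivWithinAt.Ici_of_Icc {F : Type*} [NormedAddCommGroup F] [NormedSpace ℝ F]
    {f : ℝ → F} {f' : F} {a b t : ℝ}
    (h : HasDerivWithinAt f f' (Icc a b) t) (ht : t ∈ Ico a b) : HasDerivWithinAt f f' (Ici t) t :=
  h.mono_of_mem_nhdsWithin (Icc_mem_nhdsGE_of_mem ht)

/-- A quasihomogeneous vector field which is monodromic has no characteristic directions. -/
theorem angular_ne_zero_of_isMonodromic {p q r : ℕ} (hp : 0 < p) (hq : 0 < q) {P Q : ℝ → ℝ → ℝ}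
    (hP : ∀ τ x y, P (τ ^ p * x) (τ ^ q * y) = τ ^ (p + r) * P x y)
    (hQ : ∀ τ x y, Q (τ ^ p * x) (τ ^ q * y) = τ ^ (q + r) * Q x y)
    (hPc : ContDiff ℝ 1 fun z : ℝ × ℝ => P z.1 z.2) (hQc : ContDiff ℝ 1 fun z : ℝ × ℝ => Q z.1 z.2)
    (h : IsMonodromic P Q) {c s : ℝ} (hcs : c ^ 2 + s ^ 2 = 1) :
    p * c * Q c s - q * s * P c s ≠ 0 := by
  intro h0
  obtain ⟨-, -, hM⟩ := h
  obtain ⟨δ, hδ, hM⟩ := hM 1 one_pos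
  obtain ⟨τ, hτ, hτδ⟩ : ∃ τ > 0, (τ ^ p * c) ^ 2 + (τ ^ q * s) ^ 2 < δ ^ 2 := by
    have hc : Tendsto (fun τ : ℝ => (τ ^ p * c) ^ 2 + (τ ^ q * s) ^ 2) (𝓝[>] 0) (𝓝 0) := by
      have : Continuous fun τ : ℝ => (τ ^ p * c) ^ 2 + (τ ^ q * s) ^ 2 := by fun_prop
      refine (this.tendsto' 0 0 ?_).mono_left nhdsWithin_le_nhds
      simp [hp.ne', hq.ne']
    obtain ⟨τ, h1, h2⟩ := ((hc.eventually (gt_mem_nhds (by positivity : 0 < δ ^ 2))).and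
      self_mem_nhdsWithin).exists
    exact ⟨τ, h2, h1⟩
  have hpos0 : 0 < (τ ^ p * c) ^ 2 + (τ ^ q * s) ^ 2 := by
    by_contra hcon
    have h1 : (τ ^ p * c) ^ 2 = 0 := by nlinarith [sq_nonneg (τ ^ p * c), sq_nonneg (τ ^ q * s)]
    have h2 : (τ ^ q * s) ^ 2 = 0 := by nlinarith [sq_nonneg (τ ^ p * c), sq_nonneg (τ ^ q * s)]
    have h3 : c = 0 := by
      simpa [(pow_pos hτ p).ne'] using h1
    have h4 : s = 0 := by
      simpa [(pow_pos hτ q).ne'] using h2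
    rw [h3, h4] at hcs; norm_num at hcs
  obtain ⟨T, hT, x, y, R, θ, hx0, hy0, hθ, hsol, hturn⟩ := hM _ _ hpos0 hτδ
  have hpR : (0 : ℝ) < p := by exact_mod_cast hp
  have hqR : (0 : ℝ) < q := by exact_mod_cast hq
  -- `N` is a norm adapted to the weights: it is multiplied by `τ` under `(x, y) ↦ (τ ^ p x, τ ^ q
  -- y)` when `τ > 0`. Dividing by it projects the orbit to the closed curve `X ^ (2q) + Y ^ (2p) =
  -- 1`.
  let w : ℝ → ℝ := fun t => x t ^ (2 * q) + y t ^ (2 * p)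
  let N : ℝ → ℝ := fun t => w t ^ ((2 * p * q : ℝ)⁻¹)
  have hw : ∀ t ∈ Icc 0 T, 0 < w t := by
    intro t ht
    obtain ⟨-, -, hR, -, hx, hy⟩ := hsol t ht
    by_contra hcon
    have e1 : 0 ≤ x t ^ (2 * q) := by rw [pow_mul]; positivity
    have e2 : 0 ≤ y t ^ (2 * p) := by rw [pow_mul]; positivity
    have e3 : x t ^ (2 * q) = 0 := by simp only [w] at hcon; linarith
    have e4 : y t ^ (2 * p) = 0 := by simp only [w] at hcon; linarith
    have e5 := pow_eq_zero_iff (by omega) |>.1 e3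
    have e6 := pow_eq_zero_iff (by omega) |>.1 e4
    rw [hx] at e5; rw [hy] at e6
    have e7 : Real.cos (θ t) = 0 := by simpa [hR.ne'] using e5
    have e8 : Real.sin (θ t) = 0 := by simpa [hR.ne'] using e6
    have := Real.sin_sq_add_cos_sq (θ t)
    rw [e7, e8] at this; norm_num at this
  have hN : ∀ t ∈ Icc 0 T, 0 < N t := fun t ht => Real.rpow_pos_of_pos (hw t ht) _
  have hNw : ∀ t ∈ Icc 0 T, N t ^ (2 * p * q) = w t := by
    intro t ht
    have := Real.rpow_inv_natCast_pow (hw t ht).le (n := 2 * p * q) (by positivity)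
    simpa [N] using this
  -- On that curve `ν` is the logarithmic derivative of `N` along the field, and `V` is the field
  -- minus `ν` times the Euler field `(p X, q Y)`. Quasihomogeneity gives `N' = N ^ (r + 1) ν(ζ)`
  -- and `ζ' = N ^ r V(ζ)`.
  let ν : ℝ × ℝ → ℝ := fun z => (q * z.1 ^ (2 * q - 1) * P z.1 z.2
    + p * z.2 ^ (2 * p - 1) * Q z.1 z.2) / (p * q)
  let V : ℝ × ℝ → ℝ × ℝ := fun z => (P z.1 z.2 - p * z.1 * ν z, Q z.1 z.2 - q * z.2 * ν z)
  let ζ : ℝ → ℝ × ℝ := fun t => (x t / N t ^ p, y t / N t ^ q)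
  have hxζ : ∀ t ∈ Icc 0 T, x t = N t ^ p * (ζ t).1 := fun t ht => by
    have := (hN t ht).ne'; simp only [ζ]; field_simp
  have hyζ : ∀ t ∈ Icc 0 T, y t = N t ^ q * (ζ t).2 := fun t ht => by
    have := (hN t ht).ne'; simp only [ζ]; field_simp
  have hζ1 : ∀ t ∈ Icc 0 T, (ζ t).1 ^ (2 * q) + (ζ t).2 ^ (2 * p) = 1 := by
    intro t ht
    have e1 := hNw t ht
    simp only [w] at e1
    rw [hxζ t ht, hyζ t ht, mul_pow, mul_pow, ← pow_mul, ← pow_mul,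
      show p * (2 * q) = 2 * p * q by ring, show q * (2 * p) = 2 * p * q by ring] at e1
    have e2 : N t ^ (2 * p * q) ≠ 0 := pow_ne_zero _ (hN t ht).ne'
    have e3 : N t ^ (2 * p * q) * ((ζ t).1 ^ (2 * q) + (ζ t).2 ^ (2 * p)) = N t ^ (2 * p * q) * 1 := by
      linear_combination -e1
    exact mul_left_cancel₀ e2 e3
  have hPζ : ∀ t ∈ Icc 0 T, P (x t) (y t) = N t ^ (p + r) * P (ζ t).1 (ζ t).2 := fun t ht => by
    rw [hxζ t ht, hyζ t ht, hP]
  have hQζ : ∀ t ∈ Icc 0 T, Q (x t) (y t) = N t ^ (q + r) * Q (ζ t).1 (ζ t).2 := fun t ht => by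
    rw [hxζ t ht, hyζ t ht, hQ]
  have hNd : ∀ t ∈ Icc 0 T, HasDerivWithinAt N (N t * (N t ^ r * ν (ζ t))) (Icc 0 T) t := by
    intro t ht
    obtain ⟨hx, hy, -⟩ := hsol t ht
    have h1 := (((hx.pow (2 * q)).add (hy.pow (2 * p))).rpow_const (p := (2 * p * q : ℝ)⁻¹)
      (Or.inl (hw t ht).ne'))
    refine h1.congr_deriv ?_
    have h2 : ((x ^ (2 * q) + y ^ (2 * p)) t) ^ ((2 * p * q : ℝ)⁻¹ - 1) = N t / w t := by
      change w t ^ ((2 * p * q : ℝ)⁻¹ - 1) = _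
      rw [Real.rpow_sub_one (hw t ht).ne']
    rw [h2, ← hNw t ht, hPζ t ht, hQζ t ht, hxζ t ht, hyζ t ht]
    have h3 : N t ≠ 0 := (hN t ht).ne'
    simp only [ν]
    push_cast
    rw [mul_pow, mul_pow, ← pow_mul, ← pow_mul]
    have h4 : N t ^ (p * (2 * q - 1)) * N t ^ (p + r) = N t ^ (2 * p * q) * N t ^ r := by
      rw [← pow_add, ← pow_add]; congr 1
      obtain ⟨k, rfl⟩ := Nat.exists_eq_add_of_lt hq
      simp only [zero_add]
      rw [show 2 * (k + 1) - 1 = 2 * k + 1 by omega]; ring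
    have h5 : N t ^ (q * (2 * p - 1)) * N t ^ (q + r) = N t ^ (2 * p * q) * N t ^ r := by
      rw [← pow_add, ← pow_add]; congr 1
      obtain ⟨k, rfl⟩ := Nat.exists_eq_add_of_lt hp
      simp only [zero_add]
      rw [show 2 * (k + 1) - 1 = 2 * k + 1 by omega]; ring
    field_simp
    linear_combination (q * (ζ t).1 ^ (2 * q - 1) * P (ζ t).1 (ζ t).2) * h4
      + (p * (ζ t).2 ^ (2 * p - 1) * Q (ζ t).1 (ζ t).2) * h5
  have hζd : ∀ t ∈ Icc 0 T, HasDerivWithinAt ζ (N t ^ r • V (ζ t)) (Icc 0 T) t := by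
    intro t ht
    obtain ⟨hx, hy, -⟩ := hsol t ht
    have h3 : N t ≠ 0 := (hN t ht).ne'
    have h1 := (hx.div ((hNd t ht).pow p) (pow_ne_zero _ h3)).prodMk
      (hy.div ((hNd t ht).pow q) (pow_ne_zero _ h3))
    refine h1.congr_deriv ?_
    simp only [V, Prod.smul_mk, smul_eq_mul, Pi.pow_apply]
    rw [hPζ t ht, hQζ t ht, hxζ t ht, hyζ t ht]
    have h4 : N t ^ (p - 1) * N t = N t ^ p := pow_sub_one_mul hp.ne' _
    have h5 : N t ^ (q - 1) * N t = N t ^ q := pow_sub_one_mul hq.ne' _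
    generalize ν (ζ t) = μ
    refine Prod.ext ?_ ?_
    · simp only
      field_simp
      rw [pow_add]
      linear_combination -((ζ t).1 * p * N t ^ r * μ) * h4
    · simp only
      field_simp
      rw [pow_add]
      linear_combination -((ζ t).2 * q * N t ^ r * μ) * h5
  have h0T : (0 : ℝ) ∈ Icc 0 T := left_mem_Icc.2 hT.le
  -- A characteristic direction is one where the field is parallel to the Euler field. The
  -- normalised starting point is therefore an equilibrium of `V`.
  have hV0 : V (ζ 0) = 0 := by
    have e1 : (ζ 0).1 = (τ / N 0) ^ p * c := by
      simp only [ζ, hx0]; rw [div_pow]; ring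
    have e2 : (ζ 0).2 = (τ / N 0) ^ q * s := by
      simp only [ζ, hy0]; rw [div_pow]; ring
    have e3 : p * (ζ 0).1 * Q (ζ 0).1 (ζ 0).2 = q * (ζ 0).2 * P (ζ 0).1 (ζ 0).2 := by
      rw [e1, e2, hP, hQ, pow_add, pow_add]
      linear_combination ((τ / N 0) ^ p * (τ / N 0) ^ q * (τ / N 0) ^ r) * h0
    have e4 := hζ1 0 h0T
    generalize ζ 0 = z at *
    obtain ⟨X, Y⟩ := z
    simp only at e3 e4
    have e5 : X ^ (2 * q - 1) * X = X ^ (2 * q) := pow_sub_one_mul (by omega) _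
    have e6 : Y ^ (2 * p - 1) * Y = Y ^ (2 * p) := pow_sub_one_mul (by omega) _
    simp only [V, ν, Prod.mk_eq_zero]
    constructor
    · field_simp
      linear_combination -q * P X Y * e4 - q * P X Y * e5 - q * P X Y * e6 - Y ^ (2 * p - 1) * e3
    · field_simp
      linear_combination -p * Q X Y * e4 - p * Q X Y * e5 - p * Q X Y * e6 + X ^ (2 * q - 1) * e3
  have hVc : ContDiff ℝ 1 V := by
    have hν : ContDiff ℝ 1 ν := by fun_prop
    fun_prop
  obtain ⟨L, hL⟩ := hVc.contDiffOn.exists_lipschitzOnWith one_ne_zero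
    (convex_closedBall (0 : ℝ × ℝ) 1) (isCompact_closedBall _ _)
  have hmem : ∀ t ∈ Icc 0 T, ζ t ∈ Metric.closedBall (0 : ℝ × ℝ) 1 := by
    intro t ht
    have e := hζ1 t ht
    have e1 : 0 ≤ (ζ t).1 ^ (2 * q) := by rw [pow_mul]; positivity
    have e2 : 0 ≤ (ζ t).2 ^ (2 * p) := by rw [pow_mul]; positivity
    rw [mem_closedBall_zero_iff, Prod.norm_def]
    refine max_le ?_ ?_
    · rw [← pow_le_one_iff_of_nonneg (norm_nonneg _) (n := 2 * q) (by omega), ← norm_pow,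
        Real.norm_of_nonneg e1]; linarith
    · rw [← pow_le_one_iff_of_nonneg (norm_nonneg _) (n := 2 * p) (by omega), ← norm_pow,
        Real.norm_of_nonneg e2]; linarith
  have hNc : ContinuousOn (fun t => N t ^ r) (Icc 0 T) :=
    ContinuousOn.pow (fun t ht => (hNd t ht).continuousWithinAt) r
  obtain ⟨B, hB⟩ := isCompact_Icc.exists_bound_of_continuousOn hNc
  -- By uniqueness the projected orbit never leaves this equilibrium, although the actual orbit must
  -- turn.
  have hconst : EqOn ζ (fun _ => ζ 0) (Icc 0 T) := by
    refine ODE_solution_unique_of_mem_Icc_right (v := fun t z => N t ^ r • V z)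
      (s := fun _ => Metric.closedBall (0 : ℝ × ℝ) 1) (K := B.toNNReal * L) ?_
      (fun t ht => (hζd t ht).continuousWithinAt)
      (fun t ht => (hζd t (Ico_subset_Icc_self ht)).Ici_of_Icc ht)
      (fun t ht => hmem t (Ico_subset_Icc_self ht)) continuousOn_const ?_
      (fun t ht => hmem 0 h0T) rfl
    · intro t ht
      have hb := hB t (Ico_subset_Icc_self ht)
      refine LipschitzOnWith.of_dist_le_mul fun z hz z' hz' => ?_
      rw [dist_smul₀, NNReal.coe_mul, mul_assoc]
      have := hL.dist_le_mul z hz z' hz'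
      refine mul_le_mul (hb.trans (Real.le_coe_toNNReal B)) this dist_nonneg (NNReal.coe_nonneg _)
    · intro t ht
      simp only [hV0, smul_zero]
      exact hasDerivWithinAt_const _ _ _
  -- After half a turn both coordinates have reversed sign up to positive factors. As `ζ` is
  -- constant, both its coordinates are zero, which contradicts the equation of the curve.
  obtain ⟨t, ht, ht'⟩ : ∃ t ∈ Icc 0 T, θ t = θ 0 + Real.pi ∨ θ t = θ 0 - Real.pi := by
    have hiv := intermediate_value_uIcc (a := 0) (b := T) (f := θ) (by rwa [uIcc_of_le hT.le])
    rw [uIcc_of_le hT.le] at hiv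
    have hpi := Real.pi_pos
    rcases abs_eq (by positivity) |>.1 hturn with h1 | h1
    · obtain ⟨t, ht, e⟩ := hiv (show θ 0 + Real.pi ∈ uIcc (θ 0) (θ T) by
        rw [uIcc_of_le (by linarith)]; constructor <;> linarith)
      exact ⟨t, ht, Or.inl e⟩
    · obtain ⟨t, ht, e⟩ := hiv (show θ 0 - Real.pi ∈ uIcc (θ 0) (θ T) by
        rw [uIcc_of_ge (by linarith)]; constructor <;> linarith)
      exact ⟨t, ht, Or.inr e⟩
  have hcos : Real.cos (θ t) = -Real.cos (θ 0) := by
    rcases ht' with e | e <;> rw [e]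
    · exact Real.cos_add_pi _
    · exact Real.cos_sub_pi _
  have hsin : Real.sin (θ t) = -Real.sin (θ 0) := by
    rcases ht' with e | e <;> rw [e]
    · exact Real.sin_add_pi _
    · exact Real.sin_sub_pi _
  obtain ⟨-, -, hR0, -, hx0', hy0'⟩ := hsol 0 h0T
  obtain ⟨-, -, hRt, -, hxt', hyt'⟩ := hsol t ht
  have hζt : ζ t = ζ 0 := hconst ht
  have key : ∀ {k : ℕ} {X C : ℝ}, N 0 ^ k * X = R 0 * C → N t ^ k * X = R t * (-C) → X = 0 := by
    intro k X C e1 e2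
    have e3 : (N t ^ k * R 0 + N 0 ^ k * R t) * X = 0 := by
      linear_combination R t * e1 + R 0 * e2
    have e4 : 0 < N t ^ k * R 0 + N 0 ^ k * R t := by
      have := hN 0 h0T; have := hN t ht; positivity
    exact (mul_eq_zero.1 e3).resolve_left e4.ne'
  have hX : (ζ 0).1 = 0 := by
    refine key (k := p) (C := Real.cos (θ 0)) ?_ ?_
    · rw [← hxζ 0 h0T, hx0']
    · rw [← hcos, ← hxt', hxζ t ht, hζt]
  have hY : (ζ 0).2 = 0 := by
    refine key (k := q) (C := Real.sin (θ 0)) ?_ ?_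
    · rw [← hyζ 0 h0T, hy0']
    · rw [← hsin, ← hyt', hyζ t ht, hζt]
  have := hζ1 0 h0T
  rw [hX, hY, zero_pow (by omega), zero_pow (by omega)] at this
  norm_num at this

end Leading

/-! ### The polar equation: existence, uniqueness and analytic dependence. -/

section Flow

lemma two_pi_nonneg : (0 : ℝ) ≤ 2 * Real.pi := Real.two_pi_pos.le

/-- The cosine, as a continuous function on `[0, 2π]`. -/
noncomputable def cosC : C(Icc 0 (2 * Real.pi), ℝ) := ⟨fun φ => Real.cos φ, by fun_prop⟩

/-- The sine, as a continuous function on `[0, 2π]`. -/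
noncomputable def sinC : C(Icc 0 (2 * Real.pi), ℝ) := ⟨fun φ => Real.sin φ, by fun_prop⟩

lemma cosC_apply (φ : Icc 0 (2 * Real.pi)) : cosC φ = Real.cos φ := rfl

lemma sinC_apply (φ : Icc 0 (2 * Real.pi)) : sinC φ = Real.sin φ := rfl

lemma exp_apply {T : Type*} [TopologicalSpace T] [CompactSpace T] (u : C(T, ℝ)) (t : T) :
    NormedSpace.exp u t = Real.exp (u t) := by
  have h := NormedSpace.map_exp (ContinuousMap.evalAlgHom (X := T) ℝ ℝ t)
    (continuous_eval_const t) u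
  rw [Real.exp_eq_exp_ℝ]
  exact h

variable {E : Type*} [NormedAddCommGroup E] [NormedSpace ℝ E]

/-- The weighted polar equation of a family of vector fields, in terms of functions which are
analytic up to `ρ = 0`. -/
theorem exists_polar_field {p q : ℕ} (hp : 0 < p) (hq : 0 < q) (r : ℕ) {P Q : E → ℝ → ℝ → ℝ}
    {a : E} (hP : AnalyticAt ℝ (fun z : ℝ × ℝ × E => P z.2.2 z.1 z.2.1) (0, 0, a))
    (hQ : AnalyticAt ℝ (fun z : ℝ × ℝ × E => Q z.2.2 z.1 z.2.1) (0, 0, a))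
    (hΘ : ∀ c s : ℝ, c ^ 2 + s ^ 2 = 1 →
      p * c * qhPart p q (Q a) (q + r) c s - q * s * qhPart p q (P a) (p + r) c s ≠ 0) :
    ∃ G ϑ : C(Icc 0 (2 * Real.pi), ℝ) × E → C(Icc 0 (2 * Real.pi), ℝ),
      AnalyticAt ℝ G (0, a) ∧ AnalyticAt ℝ ϑ (0, a) ∧ (∀ φ, ϑ (0, a) φ ≠ 0) ∧
      ∀ᶠ z in 𝓝 ((0 : C(Icc 0 (2 * Real.pi), ℝ)), a), ∀ φ : Icc 0 (2 * Real.pi), 0 < z.1 φ →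
        polarTheta p q r (truncation p q (p + r) (P z.2)) (truncation p q (q + r) (Q z.2))
          φ (z.1 φ) * ϑ z φ = 1 ∧
        polarR p q r (truncation p q (p + r) (P z.2)) (truncation p q (q + r) (Q z.2)) φ (z.1 φ) /
          polarTheta p q r (truncation p q (p + r) (P z.2)) (truncation p q (q + r) (Q z.2))
            φ (z.1 φ) = z.1 φ * G z φ := by
  obtain ⟨A, hA, hA0, hAe⟩ := exists_blowup hp hq (p + r) hP cosC sinC
  obtain ⟨B, hB, hB0, hBe⟩ := exists_blowup hp hq (q + r) hQ cosC sinC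
  let θ : C(Icc 0 (2 * Real.pi), ℝ) × E → C(Icc 0 (2 * Real.pi), ℝ) :=
    fun z => (p : ℝ) • (cosC * B z) - (q : ℝ) • (sinC * A z)
  have hθ : AnalyticAt ℝ θ (0, a) :=
    (analyticAt_const.fun_smul (analyticAt_const.mul hB)).sub
      (analyticAt_const.fun_smul (analyticAt_const.mul hA))
  have hθφ : ∀ z φ, θ z φ = p * (Real.cos φ * B z φ) - q * (Real.sin φ * A z φ) :=
    fun z φ => rfl
  -- At `ρ = 0` the angular component vanishes nowhere on `[0, 2π]`, so it is a unit of the Banach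
  -- algebra of continuous functions. Units form an open set on which inversion is analytic.
  have hu : IsUnit (θ (0, a)) := by
    rw [ContinuousMap.isUnit_iff_forall_ne_zero]
    intro φ
    rw [hθφ, hA0, hB0, cosC_apply, sinC_apply, ← mul_assoc, ← mul_assoc]
    exact hΘ _ _ (by rw [add_comm]; exact Real.sin_sq_add_cos_sq _)
  have hinv : AnalyticAt ℝ (fun z => Ring.inverse (θ z)) (0, a) := by
    obtain ⟨w, hw⟩ := hu
    refine AnalyticAt.comp (g := Ring.inverse) ?_ hθ
    rw [← hw]; exact analyticAt_inverse w
  have hue : ∀ᶠ z in 𝓝 ((0 : C(Icc 0 (2 * Real.pi), ℝ)), a), IsUnit (θ z) :=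
    hθ.continuousAt.eventually (Units.isOpen.mem_nhds hu)
  have hmul : ∀ z, IsUnit (θ z) → ∀ φ, θ z φ * Ring.inverse (θ z) φ = 1 := by
    intro z hz φ
    have := congrArg (fun u : C(Icc 0 (2 * Real.pi), ℝ) => u φ) (Ring.mul_inverse_cancel _ hz)
    simpa using this
  refine ⟨fun z => (cosC * A z + sinC * B z) * Ring.inverse (θ z), fun z => Ring.inverse (θ z),
    ((analyticAt_const.mul hA).add (analyticAt_const.mul hB)).mul hinv, hinv,
    fun φ => right_ne_zero_of_mul_eq_one (hmul _ hu φ), ?_⟩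
  filter_upwards [hAe, hBe, hue] with z h1 h2 h3 φ hφ
  have e1 := h1 φ
  have e2 := h2 φ
  rw [cosC_apply, sinC_apply] at e1 e2
  have e3 := hmul z h3 φ
  have e4 : polarTheta p q r (truncation p q (p + r) (P z.2)) (truncation p q (q + r) (Q z.2))
      φ (z.1 φ) = θ z φ := by
    rw [polarTheta, e1, e2, hθφ]
    field_simp
    ring
  have e5 : polarR p q r (truncation p q (p + r) (P z.2)) (truncation p q (q + r) (Q z.2))
      φ (z.1 φ) = z.1 φ * (Real.cos φ * A z φ + Real.sin φ * B z φ) := by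
    rw [polarR, e1, e2]
    field_simp
    ring
  refine ⟨by rw [e4]; exact e3, ?_⟩
  rw [e4, e5]
  simp only [ContinuousMap.mul_apply, ContinuousMap.add_apply, cosC_apply, sinC_apply]
  rw [div_eq_of_eq_mul (left_ne_zero_of_mul_eq_one e3)]
  linear_combination (-z.1 φ * (Real.cos φ * A z φ + Real.sin φ * B z φ)) * e3

/-- Analytic dependence on initial conditions and parameters for an equation `ρ' = ρ G(ρ)`: its
small solutions are `ρ₀ exp V`, where `V` is analytic in `ρ₀` and the parameters. -/
theorem exists_exp_solution [CompleteSpace E] {τ : ℝ} (hτ : 0 ≤ τ)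
    {G : C(Icc 0 τ, ℝ) × E → C(Icc 0 τ, ℝ)} {a : E} (hG : AnalyticAt ℝ G (0, a)) :
    ∃ V : ℝ × E → C(Icc 0 τ, ℝ), AnalyticAt ℝ V (0, a) ∧
      ∀ᶠ z in 𝓝 ((0 : ℝ), a), V z = primitive hτ (G (z.1 • NormedSpace.exp (V z), z.2)) := by
  let v₀ := primitive hτ (G (0, a))
  let u : (ℝ × E) × C(Icc 0 τ, ℝ) := ((0, a), v₀)
  -- For `ρ = x exp v` the equation reads `v' = G(ρ)`, with `v(0) = 0`; in integrated form it is `H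
  -- = 0`, which makes sense also at `x = 0`.
  let H : (ℝ × E) × C(Icc 0 τ, ℝ) → C(Icc 0 τ, ℝ) :=
    fun w => w.2 - primitive hτ (G (w.1.1 • NormedSpace.exp w.2, w.1.2))
  have hH : AnalyticAt ℝ H u := by
    refine analyticAt_snd.sub (((primitive hτ).analyticAt _).comp ?_)
    have h1 : AnalyticAt ℝ (fun w : (ℝ × E) × C(Icc 0 τ, ℝ) => w.1.1) u :=
      analyticAt_fst.comp analyticAt_fst
    have h2 : AnalyticAt ℝ (fun w : (ℝ × E) × C(Icc 0 τ, ℝ) => w.1.2) u :=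
      analyticAt_snd.comp analyticAt_fst
    have h3 : AnalyticAt ℝ (fun w : (ℝ × E) × C(Icc 0 τ, ℝ) => NormedSpace.exp w.2) u :=
      AnalyticAt.comp (g := NormedSpace.exp) (NormedSpace.exp_analytic _) analyticAt_snd
    refine AnalyticAt.comp (g := G) ?_ ((h1.fun_smul h3).prod h2)
    simpa [u] using hG
  have hHu : H u = 0 := by simp [H, u, v₀]
  have hcd : ContDiffAt ℝ ω H u := hH.contDiffAt
  -- At `x = 0` the integral term no longer involves `v`, so the partial derivative in `v` is the
  -- identity.
  have hinr : fderiv ℝ H u ∘L .inr ℝ (ℝ × E) C(Icc 0 τ, ℝ) = ContinuousLinearMap.id ℝ _ := by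
    have h1 : HasFDerivAt (fun v : C(Icc 0 τ, ℝ) => (((0 : ℝ), a), v))
        (ContinuousLinearMap.inr ℝ (ℝ × E) C(Icc 0 τ, ℝ)) v₀ := hasFDerivAt_prodMk_right _ _
    have h2 := HasFDerivAt.comp v₀ (g := H) hH.differentiableAt.hasFDerivAt h1
    have h3 : (H ∘ fun v : C(Icc 0 τ, ℝ) => (((0 : ℝ), a), v)) = fun v => v - v₀ := by
      funext v; simp [H, v₀]
    rw [h3] at h2
    exact h2.unique ((hasFDerivAt_id v₀).sub_const v₀)
  have hiv : (fderiv ℝ H u ∘L .inr ℝ (ℝ × E) C(Icc 0 τ, ℝ)).IsInvertible := by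
    rw [hinr]; exact ⟨ContinuousLinearEquiv.refl ℝ _, rfl⟩
  refine ⟨hcd.implicitFunction (by simp) hiv, ?_, ?_⟩
  · exact (hcd.contDiffAt_implicitFunction (by simp) hiv).analyticAt
  · filter_upwards [hcd.eventually_apply_implicitFunction (by simp) hiv] with z hz
    rw [hHu] at hz
    exact sub_eq_zero.1 hz

/-- Uniqueness for a scalar equation which is Lipschitz near zero. -/
theorem eqOn_of_lipschitzOnWith_Ioo {v : ℝ → ℝ → ℝ} {K : NNReal} {ε T : ℝ} {f g : ℝ → ℝ}
    (hv : ∀ t ∈ Icc 0 T, LipschitzOnWith K (v t) (Ioo 0 ε))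
    (hf : ∀ t ∈ Icc 0 T, HasDerivWithinAt f (v t (f t)) (Icc 0 T) t)
    (hg : ∀ t ∈ Icc 0 T, HasDerivWithinAt g (v t (g t)) (Icc 0 T) t)
    (hf0 : ∀ t ∈ Icc 0 T, 0 < f t) (hg0 : ∀ t ∈ Icc 0 T, g t ∈ Ioo 0 ε) (h0 : f 0 = g 0) :
    EqOn f g (Icc 0 T) := by
  have hfc : ContinuousOn f (Icc 0 T) := fun t ht => (hf t ht).continuousWithinAt
  have hgc : ContinuousOn g (Icc 0 T) := fun t ht => (hg t ht).continuousWithinAt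
  refine IsClosed.Icc_subset_of_forall_exists_gt (s := {t | f t = g t}) ?_ h0 ?_
  · have := (hfc.sub hgc).preimage_isClosed_of_isClosed isClosed_Icc (isClosed_singleton (x := 0))
    convert this using 1
    ext t
    simp [sub_eq_zero, and_comm]
  · rintro x ⟨hx : f x = g x, hxT⟩ y hy
    have hxI : x ∈ Icc 0 T := Ico_subset_Icc_self hxT
    -- Only `g` is assumed to stay below `ε`. Agreement at `x` keeps `f` below `ε` a little further,
    -- where the Lipschitz estimate applies to both.
    have hev : ∀ᶠ t in 𝓝[Icc 0 T] x, f t < ε :=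
      (hfc x hxI).eventually (gt_mem_nhds (by rw [hx]; exact (hg0 x hxI).2))
    obtain ⟨d, hd, hdε⟩ := Metric.mem_nhdsWithin_iff.1 hev
    have hxy : x < y := hy
    let y' := min (min y T) (x + d / 2)
    have hxy' : x < y' := lt_min (lt_min hxy hxT.2) (by linarith)
    have hy'T : y' ≤ T := (min_le_left _ _).trans (min_le_right _ _)
    have hsub : Icc x y' ⊆ Icc 0 T := Icc_subset_Icc hxT.1 hy'T
    have hfε : ∀ t ∈ Icc x y', f t < ε := by
      intro t ht
      refine hdε ⟨?_, hsub ht⟩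
      rw [Metric.mem_ball, Real.dist_eq, abs_of_nonneg (by linarith [ht.1])]
      have : y' ≤ x + d / 2 := min_le_right _ _
      linarith [ht.2]
    have hIci : ∀ {k : ℝ → ℝ}, (∀ t ∈ Icc 0 T, HasDerivWithinAt k (v t (k t)) (Icc 0 T) t) →
        ∀ t ∈ Ico x y', HasDerivWithinAt k (v t (k t)) (Ici t) t := fun hk t ht =>
      ((hk t (hsub (Ico_subset_Icc_self ht))).mono hsub).Ici_of_Icc ht
    have := ODE_solution_unique_of_mem_Icc_right (v := v) (s := fun _ => Ioo 0 ε) (K := K)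
      (fun t ht => hv t (hsub (Ico_subset_Icc_self ht))) (hfc.mono hsub) (hIci hf)
      (fun t ht => ⟨hf0 t (hsub (Ico_subset_Icc_self ht)), hfε t (Ico_subset_Icc_self ht)⟩)
      (hgc.mono hsub) (hIci hg)
      (fun t ht => hg0 t (hsub (Ico_subset_Icc_self ht))) hx
    exact ⟨y', this (right_mem_Icc.2 hxy'.le), hxy',
      (min_le_left _ _).trans (min_le_left _ _)⟩

/-- The curve `x exp v`. -/
noncomputable abbrev expCurve (x : ℝ) (v : C(Icc 0 (2 * Real.pi), ℝ)) : C(Icc 0 (2 * Real.pi), ℝ) :=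
  x • NormedSpace.exp v

lemma expCurve_apply (x : ℝ) (v : C(Icc 0 (2 * Real.pi), ℝ)) (φ : Icc 0 (2 * Real.pi)) :
    expCurve x v φ = x * NormedSpace.exp v φ := rfl

lemma uniform_pos_lt {τ : ℝ} {u : C(Icc 0 τ, ℝ)} {ε : ℝ} (h : ‖u‖ < ε) (t : Icc 0 τ) : u t < ε :=
  (le_abs_self _).trans_lt ((u.norm_coe_le_norm t).trans_lt h)

/-- Existence and uniqueness of the polar solutions of a family of vector fields, and their
analytic dependence on the initial condition and the parameters. -/
theorem exists_polar_flow [CompleteSpace E] {p q r : ℕ} {P Q : E → ℝ → ℝ → ℝ} {a : E}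
    {G ϑ : C(Icc 0 (2 * Real.pi), ℝ) × E → C(Icc 0 (2 * Real.pi), ℝ)}
    (hG : AnalyticAt ℝ G (0, a))
    (hfield : ∀ᶠ z in 𝓝 ((0 : C(Icc 0 (2 * Real.pi), ℝ)), a),
      ∀ φ : Icc 0 (2 * Real.pi), 0 < z.1 φ →
        polarTheta p q r (P z.2) (Q z.2) φ (z.1 φ) * ϑ z φ = 1 ∧
        polarR p q r (P z.2) (Q z.2) φ (z.1 φ) / polarTheta p q r (P z.2) (Q z.2) φ (z.1 φ)
          = z.1 φ * G z φ) :
    ∃ V : ℝ × E → C(Icc 0 (2 * Real.pi), ℝ), AnalyticAt ℝ V (0, a) ∧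
      (∀ z, 0 < z.1 → ∀ φ, 0 < (expCurve z.1 (V z)) φ) ∧
      ∀ᶠ z in 𝓝 ((0 : ℝ), a), V z ⟨0, left_mem_Icc.2 two_pi_nonneg⟩ = 0 ∧ (0 < z.1 →
        IsPolarSolution p q r (P z.2) (Q z.2) z.1
          (IccExtend two_pi_nonneg (expCurve z.1 (V z))) ∧
        ∀ ρ, IsPolarSolution p q r (P z.2) (Q z.2) z.1 ρ → ∀ φ : Icc 0 (2 * Real.pi),
          ρ φ = (expCurve z.1 (V z)) φ) := by
  obtain ⟨V, hV, hVe⟩ := exists_exp_solution two_pi_nonneg hG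
  have hpos : ∀ z, 0 < z.1 → ∀ φ, 0 < (expCurve z.1 (V z)) φ := by
    intro z hz φ
    rw [expCurve_apply, exp_apply]
    positivity
  refine ⟨V, hV, hpos, ?_⟩
  let u : ℝ × E → C(Icc 0 (2 * Real.pi), ℝ) := fun z => expCurve z.1 (V z)
  have hu : AnalyticAt ℝ u (0, a) := analyticAt_fst.fun_smul
    (AnalyticAt.comp (g := NormedSpace.exp) (NormedSpace.exp_analytic _) hV)
  have hu0 : u (0, a) = 0 := by simp [u]
  have hut : Tendsto (fun z => (u z, z.2)) (𝓝 ((0 : ℝ), a)) (𝓝 (0, a)) := by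
    have := (hu.prod analyticAt_snd).continuousAt.tendsto
    simpa only [hu0] using this
  -- Constant functions recover the pointwise right-hand side as `x G(x, b)(φ)`. A Lipschitz bound
  -- in the supremum norm is then uniform in `φ`.
  let j : ℝ × E → C(Icc 0 (2 * Real.pi), ℝ) × E := fun z => (z.1 • 1, z.2)
  have hj : AnalyticAt ℝ j (0, a) :=
    (analyticAt_fst.fun_smul analyticAt_const).prod analyticAt_snd
  have hj0 : j (0, a) = (0, a) := by simp [j]
  have hjt : Tendsto j (𝓝 ((0 : ℝ), a)) (𝓝 (0, a)) := by
    have := hj.continuousAt.tendsto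
    rwa [hj0] at this
  have hH : AnalyticAt ℝ (fun z : ℝ × E => z.1 • G (j z)) (0, a) :=
    analyticAt_fst.fun_smul (AnalyticAt.comp (g := G) (by rwa [hj0]) hj)
  obtain ⟨K, U, hU, hKU⟩ := (hH.contDiffAt (n := 1)).exists_lipschitzOnWith
  obtain ⟨ε, hε, hball⟩ := Metric.eventually_nhds_iff_ball.1 ((hjt.eventually hfield).and
    (show ∀ᶠ z in 𝓝 ((0 : ℝ), a), z ∈ U from hU))
  have hmem : ∀ x b, x ∈ Ioo (0 : ℝ) ε → b ∈ Metric.ball a ε → (x, b) ∈ Metric.ball ((0 : ℝ), a) ε := by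
    intro x b hx hb
    rw [Metric.mem_ball, Prod.dist_eq]
    refine max_lt ?_ hb
    rw [Real.dist_0_eq_abs, abs_of_pos hx.1]; exact hx.2
  have hsmall : ∀ᶠ z in 𝓝 ((0 : ℝ), a), ‖u z‖ < ε := by
    have := hu.continuousAt.norm.tendsto
    rw [hu0, norm_zero] at this
    exact this.eventually (gt_mem_nhds hε)
  filter_upwards [hVe, hut.eventually hfield, hsmall,
    continuousAt_snd.eventually (Metric.ball_mem_nhds a hε)] with z h1 h2 h3 h4
  have hV0 : V z ⟨0, left_mem_Icc.2 two_pi_nonneg⟩ = 0 := by rw [h1, primitive_zero]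
  refine ⟨hV0, fun hz => ?_⟩
  have hsol : IsPolarSolution p q r (P z.2) (Q z.2) z.1 (IccExtend two_pi_nonneg (u z)) := by
    constructor
    · rw [IccExtend_of_mem _ _ (left_mem_Icc.2 two_pi_nonneg)]
      simp [u, exp_apply, hV0]
    · intro φ hφ
      have e1 : IccExtend two_pi_nonneg (u z) φ = u z ⟨φ, hφ⟩ := IccExtend_of_mem _ _ hφ
      have e2 := hpos z hz ⟨φ, hφ⟩
      have e3 := h2 ⟨φ, hφ⟩ e2
      rw [e1]
      refine ⟨e2, left_ne_zero_of_mul_eq_one e3.1, ?_⟩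
      have e4 := hasDerivWithinAt_iccExtend_primitive two_pi_nonneg (G (u z, z.2)) ⟨φ, hφ⟩
      have e5 := (e4.exp).const_mul z.1
      refine (e5.congr_deriv ?_).congr ?_ ?_
      · refine Eq.trans ?_ e3.2.symm
        rw [IccExtend_val, ← h1]
        simp only [u, ContinuousMap.smul_apply, exp_apply, smul_eq_mul]
        ring
      · intro t ht
        rw [IccExtend_of_mem _ _ ht, IccExtend_of_mem _ _ ht, ← h1]
        simp [u, exp_apply]
      · rw [e1, IccExtend_val, ← h1]
        simp [u, exp_apply]
  refine ⟨hsol, fun ρ hρ φ => ?_⟩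
  have hlip : ∀ t ∈ Icc 0 (2 * Real.pi), LipschitzOnWith K
      (fun x => polarR p q r (P z.2) (Q z.2) t x / polarTheta p q r (P z.2) (Q z.2) t x)
      (Ioo 0 ε) := by
    intro t ht
    refine LipschitzOnWith.of_dist_le_mul fun x hx y hy => ?_
    have e1 : ∀ x ∈ Ioo 0 ε,
        polarR p q r (P z.2) (Q z.2) t x / polarTheta p q r (P z.2) (Q z.2) t x
          = (x • G (j (x, z.2))) ⟨t, ht⟩ := by
      intro x hx
      have := ((hball _ (hmem x z.2 hx h4)).1 ⟨t, ht⟩ (by simpa [j] using hx.1)).2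
      simpa [j] using this
    rw [e1 x hx, e1 y hy]
    have e2 := hKU.dist_le_mul _ (hball _ (hmem x z.2 hx h4)).2 _ (hball _ (hmem y z.2 hy h4)).2
    have e3 : dist (x, z.2) (y, z.2) = dist x y := by simp [Prod.dist_eq]
    rw [e3] at e2
    exact (ContinuousMap.dist_apply_le_dist _).trans e2
  have heq := eqOn_of_lipschitzOnWith_Ioo hlip (fun t ht => (hρ.2 t ht).2.2)
    (fun t ht => (hsol.2 t ht).2.2) (fun t ht => (hρ.2 t ht).1)
    (fun t ht => ⟨(hsol.2 t ht).1, by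
      rw [IccExtend_of_mem _ _ ht]; exact uniform_pos_lt h3 _⟩) (hρ.1.trans hsol.1.symm) φ.2
  rw [heq, IccExtend_val]

end Flow

/-! ### Quasihomogeneous polynomials on the unit circle. -/

section Circle

lemma exists_cos_sin_eq {c s : ℝ} (h : c ^ 2 + s ^ 2 = 1) :
    ∃ φ : ℝ, Real.cos φ = c ∧ Real.sin φ = s := by
  have hn : ‖(⟨c, s⟩ : ℂ)‖ = 1 := by
    rw [Complex.norm_eq_sqrt_sq_add_sq, h, Real.sqrt_one]
  refine ⟨Complex.arg ⟨c, s⟩, ?_, ?_⟩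
  · have := Complex.norm_mul_cos_arg ⟨c, s⟩
    rwa [hn, one_mul] at this
  · have := Complex.norm_mul_sin_arg ⟨c, s⟩
    rwa [hn, one_mul] at this

/-- A quasihomogeneous polynomial vanishing on the unit circle vanishes identically. -/
theorem qhPart_eq_zero_of_circle {p q : ℕ} (hp : 0 < p) (hq : 0 < q) {f : ℝ → ℝ → ℝ} {j : ℕ}
    (h : ∀ φ : ℝ, qhPart p q f j (Real.cos φ) (Real.sin φ) = 0) (x y : ℝ) :
    qhPart p q f j x y = 0 := by
  by_cases hxy : x = 0 ∧ y = 0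
  · have h1 := qhPart_homogeneous p q f j 0 1 0
    have h2 := h 0
    rw [Real.cos_zero, Real.sin_zero] at h2
    rw [h2, zero_pow hp.ne', zero_pow hq.ne', zero_mul, zero_mul, mul_zero] at h1
    rw [hxy.1, hxy.2, h1]
  -- The weighted dilations of `(x, y)` meet the unit circle, by the intermediate value theorem, and
  -- homogeneity carries the zero back.
  · let g : ℝ → ℝ := fun τ => (τ ^ p * x) ^ 2 + (τ ^ q * y) ^ 2
    have hg : Continuous g := by fun_prop
    have hg0 : g 0 = 0 := by simp [g, hp.ne', hq.ne']
    -- The dilation `1 + |z|⁻¹` is large enough to leave the open disc, since `(1 + |z|⁻¹) |z| = |z|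
    -- + 1`.
    have key : ∀ {k : ℕ} {z : ℝ}, 0 < k → z ≠ 0 → 1 ≤ ((1 + |z|⁻¹) ^ k * z) ^ 2 := by
      intro k z hk hz
      have hz' : 0 < |z| := abs_pos.2 hz
      rw [one_le_sq_iff_one_le_abs, abs_mul, abs_of_pos (by positivity : 0 < (1 + |z|⁻¹) ^ k)]
      have h1 : 1 + |z|⁻¹ ≤ (1 + |z|⁻¹) ^ k :=
        le_self_pow₀ (by linarith [inv_pos.2 hz']) hk.ne'
      calc (1 : ℝ) ≤ (1 + |z|⁻¹) * |z| := by
            rw [add_mul, inv_mul_cancel₀ hz'.ne']; linarith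
        _ ≤ _ := by gcongr
    obtain ⟨τ₁, hτ₁, hg1⟩ : ∃ τ₁ : ℝ, 0 ≤ τ₁ ∧ 1 ≤ g τ₁ := by
      by_cases hx : x = 0
      · have hy : y ≠ 0 := fun hy => hxy ⟨hx, hy⟩
        refine ⟨1 + |y|⁻¹, by positivity, (key hq hy).trans ?_⟩
        exact le_add_of_nonneg_left (sq_nonneg _)
      · refine ⟨1 + |x|⁻¹, by positivity, (key hp hx).trans ?_⟩
        exact le_add_of_nonneg_right (sq_nonneg _)
    obtain ⟨τ, hτ, hgτ⟩ := intermediate_value_Icc hτ₁ hg.continuousOn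
      (show (1 : ℝ) ∈ Icc (g 0) (g τ₁) from ⟨by rw [hg0]; exact zero_le_one, hg1⟩)
    have hτ0 : τ ≠ 0 := by
      rintro rfl
      rw [hg0] at hgτ; exact zero_ne_one hgτ
    obtain ⟨φ, hc, hs⟩ := exists_cos_sin_eq hgτ
    have h1 := h φ
    rw [hc, hs, qhPart_homogeneous] at h1
    exact (mul_eq_zero.1 h1).resolve_left (pow_ne_zero _ hτ0)

lemma analyticOnNhd_qhPart_circle (p q : ℕ) (f : ℝ → ℝ → ℝ) (j : ℕ) :
    AnalyticOnNhd ℝ (fun φ : ℝ => qhPart p q f j (Real.cos φ) (Real.sin φ)) univ := by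
  intro φ _
  exact AnalyticAt.comp (g := fun z : ℝ × ℝ => qhPart p q f j z.1 z.2)
    (f := fun φ : ℝ => (Real.cos φ, Real.sin φ)) (analyticAt_qhPart p q f j _)
    (Real.analyticAt_cos.prod Real.analyticAt_sin)

lemma eq_zero_of_Icc_two_pi {f : ℝ → ℝ} (hf : AnalyticOnNhd ℝ f univ)
    (h : ∀ φ ∈ Icc 0 (2 * Real.pi), f φ = 0) : ∀ φ, f φ = 0 := by
  have hπ := Real.pi_pos
  have h1 : f =ᶠ[𝓝 Real.pi] 0 := by
    filter_upwards [Icc_mem_nhds hπ (by linarith : Real.pi < 2 * Real.pi)] with φ hφ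
    exact h φ hφ
  have h2 := hf.eq_of_eventuallyEq (g := 0) (fun _ _ => analyticAt_const) h1
  exact fun φ => congrFun h2 φ

lemma qhPart_eq_zero_of_Icc {p q : ℕ} (hp : 0 < p) (hq : 0 < q) {f : ℝ → ℝ → ℝ} {j : ℕ}
    (h : ∀ φ ∈ Icc 0 (2 * Real.pi), qhPart p q f j (Real.cos φ) (Real.sin φ) = 0) (x y : ℝ) :
    qhPart p q f j x y = 0 :=
  qhPart_eq_zero_of_circle hp hq
    (eq_zero_of_Icc_two_pi (analyticOnNhd_qhPart_circle p q f j) h) x y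

/-- Analytic functions on the line have no zero divisors: near a point where one factor is nonzero
the other vanishes, hence it vanishes everywhere. -/
lemma qhPart_eq_zero_of_mul {p q : ℕ} (hp : 0 < p) (hq : 0 < q) {f g : ℝ → ℝ → ℝ} {i j : ℕ}
    (h : ∀ φ ∈ Icc 0 (2 * Real.pi), qhPart p q f i (Real.cos φ) (Real.sin φ) *
      qhPart p q g j (Real.cos φ) (Real.sin φ) = 0)
    (hg : ∃ x y, qhPart p q g j x y ≠ 0) (x y : ℝ) : qhPart p q f i x y = 0 := by
  have hfa := analyticOnNhd_qhPart_circle p q f i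
  have hga := analyticOnNhd_qhPart_circle p q g j
  have h1 := eq_zero_of_Icc_two_pi (hfa.mul hga) h
  obtain ⟨φ₀, hφ₀⟩ : ∃ φ₀ : ℝ, qhPart p q g j (Real.cos φ₀) (Real.sin φ₀) ≠ 0 := by
    by_contra! hcon
    obtain ⟨x, y, hxy⟩ := hg
    exact hxy (qhPart_eq_zero_of_circle hp hq hcon x y)
  have h2 : (fun φ : ℝ => qhPart p q f i (Real.cos φ) (Real.sin φ)) =ᶠ[𝓝 φ₀] 0 := by
    filter_upwards [(hga φ₀ (mem_univ _)).continuousAt.eventually_ne hφ₀] with φ hφ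
    exact (mul_eq_zero.1 (h1 φ)).resolve_right hφ
  have h3 := hfa.eq_of_eventuallyEq (g := 0) (fun _ _ => analyticAt_const) h2
  exact qhPart_eq_zero_of_circle hp hq (fun φ => congrFun h3 φ) x y

end Circle

/-! ### The linear equation satisfied by an invariant curve along orbits. -/

section Cofactor

lemma polarD_pos {p q : ℕ} (hp : 0 < p) (hq : 0 < q) (φ : ℝ) : 0 < polarD p q φ := by
  have hp' : (0 : ℝ) < p := by exact_mod_cast hp
  have hq' : (0 : ℝ) < q := by exact_mod_cast hq
  have h := Real.sin_sq_add_cos_sq φ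
  rw [polarD]
  by_cases hc : Real.cos φ = 0
  · rw [hc] at h ⊢
    have : Real.sin φ ^ 2 = 1 := by linarith
    rw [this]; simpa using hq'
  · positivity

/-- The equation satisfied along a polar solution by a function with a cofactor. -/
theorem hasDerivWithinAt_curve {p q r : ℕ} {P Q F K : ℝ → ℝ → ℝ} {ρ : ℝ → ℝ} {φ : ℝ} {I : Set ℝ}
    (hρ : 0 < ρ φ) (hΘ : polarTheta p q r P Q φ (ρ φ) ≠ 0)
    (hd : HasDerivWithinAt ρ (polarR p q r P Q φ (ρ φ) / polarTheta p q r P Q φ (ρ φ)) I φ)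
    (hF : DifferentiableAt ℝ (fun z : ℝ × ℝ => F z.1 z.2)
      (ρ φ ^ p * Real.cos φ, ρ φ ^ q * Real.sin φ))
    (hK : (fun z : ℝ × ℝ => P z.1 z.2 * deriv (fun x => F x z.2) z.1
      + Q z.1 z.2 * deriv (fun y => F z.1 y) z.2 = K z.1 z.2 * F z.1 z.2)
      (ρ φ ^ p * Real.cos φ, ρ φ ^ q * Real.sin φ)) :
    HasDerivWithinAt (fun φ => F (ρ φ ^ p * Real.cos φ) (ρ φ ^ q * Real.sin φ))
      (polarCofactor p q r P Q K φ (ρ φ) * F (ρ φ ^ p * Real.cos φ) (ρ φ ^ q * Real.sin φ)) I φ := by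
  set x := ρ φ ^ p * Real.cos φ with hx
  set y := ρ φ ^ q * Real.sin φ with hy
  have hFx : HasDerivAt (fun x => F x y) (fderiv ℝ (fun z : ℝ × ℝ => F z.1 z.2) (x, y) (1, 0)) x :=
    HasFDerivAt.comp_hasDerivAt x (l := fun z : ℝ × ℝ => F z.1 z.2) (f := fun x => (x, y))
      hF.hasFDerivAt ((hasDerivAt_id x).prodMk (hasDerivAt_const x y))
  have hFy : HasDerivAt (fun y => F x y) (fderiv ℝ (fun z : ℝ × ℝ => F z.1 z.2) (x, y) (0, 1)) y :=
    HasFDerivAt.comp_hasDerivAt y (l := fun z : ℝ × ℝ => F z.1 z.2) (f := fun y => (x, y))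
      hF.hasFDerivAt ((hasDerivAt_const y x).prodMk (hasDerivAt_id y))
  simp only [hFx.deriv, hFy.deriv] at hK
  -- The curve `φ ↦ (ρ ^ p cos φ, ρ ^ q sin φ)` has velocity `D / (ρ ^ r Θ)` times `(P, Q)`, the
  -- factor present in `polarCofactor`. The computation below verifies this.
  have hxd := (hd.pow p).mul (Real.hasDerivAt_cos φ).hasDerivWithinAt
  have hyd := (hd.pow q).mul (Real.hasDerivAt_sin φ).hasDerivWithinAt
  have hw := HasFDerivAt.comp_hasDerivWithinAt φ (l := fun z : ℝ × ℝ => F z.1 z.2)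
    (f := fun φ => (ρ φ ^ p * Real.cos φ, ρ φ ^ q * Real.sin φ)) hF.hasFDerivAt (hxd.prodMk hyd)
  refine hw.congr_deriv ?_
  generalize fderiv ℝ (fun z : ℝ × ℝ => F z.1 z.2) (x, y) = L at hK ⊢
  have hL : ∀ α β : ℝ, L (α, β) = α * L (1, 0) + β * L (0, 1) := by
    intro α β
    have : ((α, β) : ℝ × ℝ) = α • (1, 0) + β • (0, 1) := by simp
    rw [this, map_add, map_smul, map_smul, smul_eq_mul, smul_eq_mul]
  rw [hL]
  generalize L (1, 0) = X at hK ⊢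
  generalize L (0, 1) = Y at hK ⊢
  rw [polarCofactor, ← hx, ← hy, div_mul_eq_mul_div, mul_assoc (polarD p q φ), ← hK]
  have hp1 : (p : ℝ) * ρ φ ^ (p - 1) * ρ φ = p * ρ φ ^ p := by
    rcases Nat.eq_zero_or_pos p with h | h
    · simp [h]
    · rw [mul_assoc, pow_sub_one_mul h.ne']
  have hq1 : (q : ℝ) * ρ φ ^ (q - 1) * ρ φ = q * ρ φ ^ q := by
    rcases Nat.eq_zero_or_pos q with h | h
    · simp [h]
    · rw [mul_assoc, pow_sub_one_mul h.ne']
  have hΘ' := hΘ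
  simp only [polarTheta, ← hx, ← hy] at hΘ'
  have hne := hρ.ne'
  simp only [polarR, polarTheta, polarD, ← hx, ← hy, Pi.pow_apply] 
  generalize P x y = A at *
  generalize Q x y = B at *
  have hM : p * ρ φ ^ p * Real.cos φ * B - q * ρ φ ^ q * Real.sin φ * A ≠ 0 := by
    intro h0; rw [h0, zero_div] at hΘ'; exact hΘ' rfl
  obtain ⟨M, hMd⟩ : ∃ M, M = p * ρ φ ^ p * Real.cos φ * B - q * ρ φ ^ q * Real.sin φ * A :=
    ⟨_, rfl⟩
  rw [← hMd] at hM ⊢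
  rw [pow_add, pow_add]
  field_simp
  generalize ρ φ ^ (p - 1) = a1 at *
  generalize ρ φ ^ (q - 1) = a2 at *
  linear_combination (X * Real.cos φ * (ρ φ ^ q * Real.cos φ * A + ρ φ ^ p * Real.sin φ * B)) * hp1
    + (Y * Real.sin φ * (ρ φ ^ q * Real.cos φ * A + ρ φ ^ p * Real.sin φ * B)) * hq1
    + (Y * ρ φ ^ q * Real.cos φ - X * ρ φ ^ p * Real.sin φ) * hMd

lemma sub_eq_primitive {τ : ℝ} (hτ : 0 ≤ τ) {f : ℝ → ℝ} {κ : C(Icc 0 τ, ℝ)}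
    (h : ∀ φ : Icc 0 τ, HasDerivWithinAt f (κ φ) (Icc 0 τ) φ) (φ : Icc 0 τ) :
    f φ - f 0 = primitive hτ κ φ := by
  have hd : ∀ t ∈ Icc 0 τ,
      HasDerivWithinAt (fun t => f t - IccExtend hτ (primitive hτ κ) t) 0 (Icc 0 τ) t := by
    intro t ht
    have := (h ⟨t, ht⟩).sub (hasDerivWithinAt_iccExtend_primitive hτ κ ⟨t, ht⟩)
    rwa [sub_self] at this
  have h1 := constant_of_has_deriv_right_zero (fun t ht => (hd t ht).continuousWithinAt)
    (fun t ht => (hd t (Ico_subset_Icc_self ht)).Ici_of_Icc ht) φ φ.2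
  simp only [IccExtend_val] at h1
  rw [IccExtend_of_mem _ _ (left_mem_Icc.2 hτ), primitive_zero] at h1
  linarith

/-- The integrating factor `exp (-∫ κ)` makes the product constant. Nothing is divided by `f`, so
zeros of `f` are allowed. -/
lemma eq_mul_exp_primitive {τ : ℝ} (hτ : 0 ≤ τ) {f : ℝ → ℝ} {κ : C(Icc 0 τ, ℝ)}
    (h : ∀ φ : Icc 0 τ, HasDerivWithinAt f (κ φ * f φ) (Icc 0 τ) φ) (φ : Icc 0 τ) :
    f φ = f 0 * Real.exp (primitive hτ κ φ) := by
  have hd : ∀ t ∈ Icc 0 τ, HasDerivWithinAt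
      (fun t => f t * Real.exp (-IccExtend hτ (primitive hτ κ) t)) 0 (Icc 0 τ) t := by
    intro t ht
    have := (h ⟨t, ht⟩).mul (hasDerivWithinAt_iccExtend_primitive hτ κ ⟨t, ht⟩).neg.exp
    refine this.congr_deriv ?_
    simp; ring
  have h1 := constant_of_has_deriv_right_zero (fun t ht => (hd t ht).continuousWithinAt)
    (fun t ht => (hd t (Ico_subset_Icc_self ht)).Ici_of_Icc ht) φ φ.2
  simp only [IccExtend_val] at h1
  rw [IccExtend_of_mem _ _ (left_mem_Icc.2 hτ), primitive_zero, neg_zero, Real.exp_zero,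
    mul_one] at h1
  rw [← h1, mul_assoc, ← Real.exp_add, neg_add_cancel, Real.exp_zero, mul_one]

end Cofactor

/-! ### The cofactor along solutions shrinking to the origin. -/

section Family

/-- A family of polar solutions `x exp (v x)`, with initial value `x > 0`, of a vector field,
together with the inverse `T x` of the angular component along them. -/
structure PolarFamily (p q r : ℕ) (P Q : ℝ → ℝ → ℝ) (v T : ℝ → C(Icc 0 (2 * Real.pi), ℝ)) :
    Prop where
  continuousAt_exponent : ContinuousAt v 0
  continuousAt_inverse : ContinuousAt T 0
  inverse_ne_zero : ∀ φ, T 0 φ ≠ 0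
  solution : ∀ᶠ x in 𝓝[>] (0 : ℝ), v x ⟨0, left_mem_Icc.2 two_pi_nonneg⟩ = 0 ∧
    IsPolarSolution p q r P Q x (IccExtend two_pi_nonneg (expCurve x (v x))) ∧
    ∀ φ : Icc 0 (2 * Real.pi), polarTheta p q r P Q φ ((expCurve x (v x)) φ) * T x φ = 1

lemma continuousAt_exp_comp {v : ℝ → C(Icc 0 (2 * Real.pi), ℝ)} (hv : ContinuousAt v 0) :
    ContinuousAt (fun x => NormedSpace.exp (v x)) 0 :=
  ContinuousAt.comp (g := NormedSpace.exp) (f := v)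
    (NormedSpace.exp_analytic (𝕂 := ℝ) (v 0)).continuousAt hv

lemma tendsto_smul_exp {v : ℝ → C(Icc 0 (2 * Real.pi), ℝ)} (hv : ContinuousAt v 0) :
    Tendsto (fun x => expCurve x (v x)) (𝓝 0) (𝓝 0) := by
  have h : ContinuousAt (fun x : ℝ => expCurve x (v x)) 0 :=
    continuousAt_id.smul (continuousAt_exp_comp hv)
  simpa [ContinuousAt, expCurve] using h

lemma exp_apply_pos (v : C(Icc 0 (2 * Real.pi), ℝ)) (φ : Icc 0 (2 * Real.pi)) :
    0 < NormedSpace.exp v φ := by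
  rw [exp_apply]; exact Real.exp_pos _

/-- Expansion along a family of curves shrinking to the origin. -/
theorem exists_blowup_along {p q : ℕ} (hp : 0 < p) (hq : 0 < q) {n : ℕ} {f : ℝ → ℝ → ℝ}
    (hf : AnalyticAt ℝ (fun z : ℝ × ℝ => f z.1 z.2) (0, 0)) (hn : StartsAt p q f n)
    {v : ℝ → C(Icc 0 (2 * Real.pi), ℝ)} (hv : ContinuousAt v 0) :
    ∃ Φ : ℝ → C(Icc 0 (2 * Real.pi), ℝ), ContinuousAt Φ 0 ∧
      (∀ φ, Φ 0 φ = qhPart p q f n (Real.cos φ) (Real.sin φ)) ∧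
      ∀ᶠ x in 𝓝 (0 : ℝ), ∀ φ : Icc 0 (2 * Real.pi),
        f ((expCurve x (v x)) φ ^ p * Real.cos φ)
          ((expCurve x (v x)) φ ^ q * Real.sin φ)
          = (expCurve x (v x)) φ ^ n * Φ x φ := by
  -- There is no true parameter here; a dummy real one is carried and kept equal to `0`.
  have hf' : AnalyticAt ℝ (fun z : ℝ × ℝ × ℝ => (fun _ : ℝ => f) z.2.2 z.1 z.2.1) (0, 0, 0) :=
    AnalyticAt.comp (g := fun z : ℝ × ℝ => f z.1 z.2) (f := fun z : ℝ × ℝ × ℝ => (z.1, z.2.1))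
      hf (analyticAt_fst.prod (analyticAt_fst.comp analyticAt_snd))
  obtain ⟨Φ, hΦ, hΦ0, hΦe⟩ := exists_blowup hp hq n (f := fun _ : ℝ => f) hf' cosC sinC
  have hut : Tendsto (fun x => (expCurve x (v x), (0 : ℝ))) (𝓝 0) (𝓝 (0, 0)) :=
    (tendsto_smul_exp hv).prodMk_nhds tendsto_const_nhds
  refine ⟨fun x => Φ (expCurve x (v x), 0), ?_, fun φ => ?_, ?_⟩
  · have := hΦ.continuousAt.tendsto.comp hut
    simpa [ContinuousAt, Function.comp_def] using this
  · change Φ (expCurve 0 (v 0), 0) φ = _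
    rw [expCurve, zero_smul, hΦ0]; rfl
  · filter_upwards [hut.eventually hΦe] with x hx φ
    have := hx φ
    rwa [truncation_of_startsAt hn] at this

lemma eventually_forall_curve {p q : ℕ} (hp : 0 < p) (hq : 0 < q)
    {v : ℝ → C(Icc 0 (2 * Real.pi), ℝ)} (hv : ContinuousAt v 0) {A : ℝ × ℝ → Prop}
    (hA : ∀ᶠ z in 𝓝 ((0 : ℝ), (0 : ℝ)), A z) :
    ∀ᶠ x in 𝓝 (0 : ℝ), ∀ φ : Icc 0 (2 * Real.pi),
      A ((expCurve x (v x)) φ ^ p * Real.cos φ,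
        (expCurve x (v x)) φ ^ q * Real.sin φ) := by
  obtain ⟨ε, hε, h⟩ := Metric.eventually_nhds_iff_ball.1 hA
  have hu := tendsto_smul_exp hv
  have h1 : Tendsto (fun x => ‖(expCurve x (v x)) ^ p * cosC‖) (𝓝 0) (𝓝 0) := by
    have := ((hu.pow p).mul_const cosC).norm
    simpa [hp.ne'] using this
  have h2 : Tendsto (fun x => ‖(expCurve x (v x)) ^ q * sinC‖) (𝓝 0) (𝓝 0) := by
    have := ((hu.pow q).mul_const sinC).norm
    simpa [hq.ne'] using this
  filter_upwards [h1.eventually (gt_mem_nhds hε), h2.eventually (gt_mem_nhds hε)]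
    with x hx1 hx2 φ
  refine h _ ?_
  rw [Metric.mem_ball, Prod.dist_eq]
  refine max_lt ?_ ?_
  · rw [dist_zero_right]
    exact (((expCurve x (v x)) ^ p * cosC).norm_coe_le_norm φ).trans_lt hx1
  · rw [dist_zero_right]
    exact (((expCurve x (v x)) ^ q * sinC).norm_coe_le_norm φ).trans_lt hx2

/-- `polarD` as a continuous function on `[0, 2π]`. -/
noncomputable def polarDC (p q : ℕ) : C(Icc 0 (2 * Real.pi), ℝ) :=
  ⟨fun φ => polarD p q φ, by unfold polarD; fun_prop⟩

variable {p q r s : ℕ} {P Q F K : ℝ → ℝ → ℝ} {v T : ℝ → C(Icc 0 (2 * Real.pi), ℝ)}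

lemma PolarFamily.hasDerivWithinAt_curve (hp : 0 < p) (hq : 0 < q)
    (h : PolarFamily p q r P Q v T) (hK : IsCofactor P Q F K) :
    ∀ᶠ x in 𝓝[>] (0 : ℝ), ∀ φ : Icc 0 (2 * Real.pi), HasDerivWithinAt
      (fun t => F (IccExtend two_pi_nonneg (expCurve x (v x)) t ^ p * Real.cos t)
        (IccExtend two_pi_nonneg (expCurve x (v x)) t ^ q * Real.sin t))
      (polarCofactor p q r P Q K φ ((expCurve x (v x)) φ) *
        F ((expCurve x (v x)) φ ^ p * Real.cos φ)
          ((expCurve x (v x)) φ ^ q * Real.sin φ)) (Icc 0 (2 * Real.pi)) φ := by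
  have h1 := eventually_forall_curve hp hq h.continuousAt_exponent
    (hK.eq.and hK.analyticAt_curve.eventually_analyticAt)
  filter_upwards [nhdsWithin_le_nhds h1, h.solution] with x hx1 hx2 φ
  have h2 := hx2.2.1.2 φ φ.2
  have h3 := MonodromicClass.hasDerivWithinAt_curve (F := F) (K := K) h2.1 h2.2.1 h2.2.2
  simp only [IccExtend_val] at h3
  exact h3 (hx1 φ).2.differentiableAt (hx1 φ).1

/-- The cofactor along the family, when its expansion starts at a degree `j ≥ r`. -/
lemma PolarFamily.exists_cofactor_eq (hp : 0 < p) (hq : 0 < q) (h : PolarFamily p q r P Q v T)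
    (hKa : AnalyticAt ℝ (fun z : ℝ × ℝ => K z.1 z.2) (0, 0)) {j : ℕ} (hj : StartsAt p q K j)
    (hrj : r ≤ j) :
    ∃ κ : ℝ → C(Icc 0 (2 * Real.pi), ℝ), ContinuousAt κ 0 ∧ ∀ᶠ x in 𝓝[>] (0 : ℝ), ∀ φ : Icc 0 (2 * Real.pi),
      polarCofactor p q r P Q K φ ((expCurve x (v x)) φ) = x ^ (j - r) * κ x φ := by
  obtain ⟨Φ, hΦ, -, hΦe⟩ := exists_blowup_along hp hq hKa hj h.continuousAt_exponent
  -- With `K = ρ ^ j Φ` and `ρ = x exp v`, division by `ρ ^ r` leaves `x ^ (j - r)` times this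
  -- continuous family.
  refine ⟨fun x => polarDC p q * NormedSpace.exp (v x) ^ (j - r) * Φ x * T x, ?_, ?_⟩
  · exact ((continuousAt_const.mul ((continuousAt_exp_comp h.continuousAt_exponent).pow _)).mul
      hΦ).mul h.continuousAt_inverse
  · filter_upwards [nhdsWithin_le_nhds hΦe, h.solution, self_mem_nhdsWithin] with x h1 h2 hx φ
    have hx' : 0 < x := hx
    have e1 := h2.2.2 φ
    have e2 := left_ne_zero_of_mul_eq_one e1
    have e3 := exp_apply_pos (v x) φ
    rw [polarCofactor, h1 φ]
    obtain ⟨d, rfl⟩ := Nat.exists_eq_add_of_le hrj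
    simp only [ContinuousMap.mul_apply, ContinuousMap.pow_apply, Nat.add_sub_cancel_left]
    have e4 : polarDC p q φ = polarD p q φ := rfl
    rw [eq_comm, eq_div_iff (mul_ne_zero (pow_ne_zero _ (by rw [expCurve_apply]; positivity)) e2),
      e4, expCurve_apply, mul_pow, mul_pow, pow_add, pow_add] 
    rw [expCurve_apply] at e1
    linear_combination (x ^ d * (polarD p q φ * NormedSpace.exp (v x) φ ^ d * Φ x φ) *
      (x ^ r * NormedSpace.exp (v x) φ ^ r)) * e1

/-- If the cofactor starts at a degree smaller than `r`, its leading term vanishes. -/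
lemma PolarFamily.qhPart_cofactor_eq_zero (hp : 0 < p) (hq : 0 < q)
    (h : PolarFamily p q r P Q v T) (hK : IsCofactor P Q F K) (hFs : StartsAt p q F s)
    (hF : ∃ x y, qhPart p q F s x y ≠ 0) {j : ℕ} (hj : StartsAt p q K j) (hjr : j < r) (x y : ℝ) :
    qhPart p q K j x y = 0 := by
  obtain ⟨Φ, hΦ, hΦ0, hΦe⟩ := exists_blowup_along hp hq hK.analyticAt_cofactor hj
    h.continuousAt_exponent
  obtain ⟨Ψ, hΨ, hΨ0, hΨe⟩ := exists_blowup_along hp hq hK.analyticAt_curve hFs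
    h.continuousAt_exponent
  -- `W` is `F / x ^ s` along the solution and `κ` is `x ^ (r - j) K̂ W`: both are continuous at `x
  -- = 0`, whereas `K̂` itself may be of size `x ^ (j - r)`.
  let W : ℝ → C(Icc 0 (2 * Real.pi), ℝ) := fun x => NormedSpace.exp (v x) ^ s * Ψ x
  let κ : ℝ → C(Icc 0 (2 * Real.pi), ℝ) :=
    fun x => polarDC p q * Φ x * T x * NormedSpace.exp (-v x) ^ (r - j) * W x
  have hW : ContinuousAt W 0 := ((continuousAt_exp_comp h.continuousAt_exponent).pow _).mul hΨ
  have hκ : ContinuousAt κ 0 := (((continuousAt_const.mul hΦ).mul h.continuousAt_inverse).mul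
    ((continuousAt_exp_comp h.continuousAt_exponent.neg).pow _)).mul hW
  have hprim : ∀ᶠ x in 𝓝[>] (0 : ℝ), ∀ φ,
      x ^ (r - j) * (W x φ - W x ⟨0, left_mem_Icc.2 two_pi_nonneg⟩)
        = primitive two_pi_nonneg (κ x) φ := by
    filter_upwards [nhdsWithin_le_nhds hΦe, nhdsWithin_le_nhds hΨe, h.solution,
      h.hasDerivWithinAt_curve hp hq hK, self_mem_nhdsWithin] with x h1 h2 h3 h4 hx φ
    have hx' : 0 < x := hx
    have hd : ∀ φ : Icc 0 (2 * Real.pi), HasDerivWithinAt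
        (fun t => x ^ (r - j) * IccExtend two_pi_nonneg (W x) t) (κ x φ)
        (Icc 0 (2 * Real.pi)) φ := by
      intro φ
      have e0 := ((h4 φ).div_const (x ^ s)).const_mul (x ^ (r - j))
      refine (e0.congr_deriv ?_).congr ?_ ?_
      · have e1 := h3.2.2 φ
        have e2 := left_ne_zero_of_mul_eq_one e1
        have e3 := exp_apply_pos (v x) φ
        rw [polarCofactor, h1 φ, h2 φ]
        obtain ⟨d, rfl⟩ := Nat.exists_eq_add_of_le hjr.le
        have e4 : polarDC p q φ = polarD p q φ := rfl
        have e5 : NormedSpace.exp (-v x) φ = (NormedSpace.exp (v x) φ)⁻¹ := by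
          rw [exp_apply, exp_apply, ContinuousMap.neg_apply, Real.exp_neg]
        simp only [κ, W, ContinuousMap.mul_apply, ContinuousMap.pow_apply,
          Nat.add_sub_cancel_left, e4, e5, inv_pow]
        rw [eq_one_div_of_mul_eq_one_right e1]
        simp only [expCurve_apply, mul_pow, pow_add] at e2 ⊢
        generalize NormedSpace.exp (v x) φ = ξ at *
        field_simp
      · intro t ht
        rw [IccExtend_of_mem _ _ ht, IccExtend_of_mem _ _ ht, h2 ⟨t, ht⟩]
        simp only [W, expCurve_apply, ContinuousMap.mul_apply, ContinuousMap.pow_apply, mul_pow]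
        field_simp
      · simp only [IccExtend_val]
        rw [h2 φ]
        simp only [W, expCurve_apply, ContinuousMap.mul_apply, ContinuousMap.pow_apply, mul_pow]
        field_simp
    rw [← sub_eq_primitive two_pi_nonneg hd, IccExtend_val,
      IccExtend_of_mem _ _ (left_mem_Icc.2 two_pi_nonneg), mul_sub]
  -- As `j < r`, the left side of `hprim` tends to zero. Thus `κ 0 = 0`, and apart from nonvanishing
  -- factors `κ 0` is `K_j F_s` on the circle.
  have hzero : primitive two_pi_nonneg (κ 0) = 0 := by
    ext φ
    have e1 : Tendsto (fun x => primitive two_pi_nonneg (κ x) φ) (𝓝[>] 0)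
        (𝓝 (primitive two_pi_nonneg (κ 0) φ)) :=
      (((ContinuousMap.evalCLM ℝ φ).comp (primitive two_pi_nonneg)).continuous.continuousAt.comp
        hκ).tendsto.mono_left nhdsWithin_le_nhds
    have e2 : ∀ φ, Tendsto (fun x => W x φ) (𝓝 0) (𝓝 (W 0 φ)) := fun φ =>
      ((ContinuousMap.evalCLM ℝ φ).continuous.continuousAt.comp hW).tendsto
    have e3 : Tendsto (fun x : ℝ => x ^ (r - j) *
        (W x φ - W x ⟨0, left_mem_Icc.2 two_pi_nonneg⟩)) (𝓝[>] 0) (𝓝 0) := by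
      have := (((continuous_pow (M := ℝ) (r - j)).tendsto 0).mul
        ((e2 φ).sub (e2 ⟨0, left_mem_Icc.2 two_pi_nonneg⟩))).mono_left
        (nhdsWithin_le_nhds (s := Ioi 0))
      rwa [zero_pow (by omega), zero_mul] at this
    exact tendsto_nhds_unique e1 (e3.congr' (hprim.mono fun x hx => hx φ))
  have hκ0 := eq_zero_of_primitive_eq_zero Real.two_pi_pos hzero
  refine qhPart_eq_zero_of_mul hp hq (fun t ht => ?_) hF x y
  rw [← hΦ0 ⟨t, ht⟩, ← hΨ0 ⟨t, ht⟩]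
  have e1 : κ 0 ⟨t, ht⟩ = 0 := by rw [hκ0]; rfl
  simp only [κ, W, ContinuousMap.mul_apply, ContinuousMap.pow_apply, mul_eq_zero] at e1
  have e2 : polarDC p q ⟨t, ht⟩ ≠ 0 := (polarD_pos hp hq t).ne'
  have e3 := h.inverse_ne_zero ⟨t, ht⟩
  have e4 : ∀ (w : C(Icc 0 (2 * Real.pi), ℝ)) k, NormedSpace.exp w ⟨t, ht⟩ ^ k ≠ 0 :=
    fun w k => pow_ne_zero _ (exp_apply_pos w _).ne'
  rw [mul_eq_zero]
  tauto

/-- The expansion of the cofactor starts at degree `r`. -/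
theorem PolarFamily.startsAt_cofactor (hp : 0 < p) (hq : 0 < q)
    (h : PolarFamily p q r P Q v T) (hK : IsCofactor P Q F K) (hFs : StartsAt p q F s)
    (hF : ∃ x y, qhPart p q F s x y ≠ 0) : StartsAt p q K r := by
  intro j
  induction j using Nat.strong_induction_on with
  | _ j ih =>
    intro hj x y
    exact h.qhPart_cofactor_eq_zero hp hq hK hFs hF
      (fun i hi => ih i hi (hi.trans hj)) hj x y

lemma integral_cofactor_eq {x : ℝ} {u κ : C(Icc 0 (2 * Real.pi), ℝ)} {f : ℝ → ℝ → ℝ}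
    (h : ∀ φ : Icc 0 (2 * Real.pi), f φ (u φ) = x * κ φ) :
    ∫ φ in (0 : ℝ)..(2 * Real.pi), f φ (IccExtend two_pi_nonneg u φ)
      = x * primitive two_pi_nonneg κ ⟨2 * Real.pi, right_mem_Icc.2 two_pi_nonneg⟩ := by
  rw [primitive_apply, ← intervalIntegral.integral_const_mul]
  refine intervalIntegral.integral_congr fun t ht => ?_
  rw [uIcc_of_le two_pi_nonneg] at ht
  simp only [IccExtend_of_mem _ _ ht]
  exact h ⟨t, ht⟩

/-- The integral of the cofactor along the polar solutions. -/
theorem PolarFamily.integral_cofactor (hp : 0 < p) (hq : 0 < q)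
    (h : PolarFamily p q r P Q v T) (hK : IsCofactor P Q F K) (hFs : StartsAt p q F s)
    (hF : ∃ x y, qhPart p q F s x y ≠ 0) :
    qhPart p q F s 1 0 ≠ 0 ∧ ∀ᶠ x in 𝓝[>] (0 : ℝ),
      ContinuousOn (fun φ => polarCofactor p q r P Q K φ
        (IccExtend two_pi_nonneg (expCurve x (v x)) φ)) (Icc 0 (2 * Real.pi)) ∧
      ∫ φ in (0 : ℝ)..(2 * Real.pi), polarCofactor p q r P Q K φ
        (IccExtend two_pi_nonneg (expCurve x (v x)) φ)
        = Real.log (F ((expCurve x (v x))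
            ⟨2 * Real.pi, right_mem_Icc.2 two_pi_nonneg⟩ ^ p) 0 / F (x ^ p) 0) := by
  obtain ⟨κ, hκ, hκe⟩ := h.exists_cofactor_eq hp hq hK.analyticAt_cofactor
    (h.startsAt_cofactor hp hq hK hFs hF) le_rfl
  simp only [Nat.sub_self, pow_zero] at hκe
  obtain ⟨Ψ, hΨ, hΨ0, hΨe⟩ := exists_blowup_along hp hq hK.analyticAt_curve hFs
    h.continuousAt_exponent
  have hexp : ∀ᶠ x in 𝓝[>] (0 : ℝ), ∀ φ : Icc 0 (2 * Real.pi),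
      F ((expCurve x (v x)) φ ^ p * Real.cos φ)
        ((expCurve x (v x)) φ ^ q * Real.sin φ)
      = F (x ^ p) 0 * Real.exp (primitive two_pi_nonneg (κ x) φ) := by
    filter_upwards [hκe, h.hasDerivWithinAt_curve hp hq hK, h.solution] with x h1 h2 h3 φ
    have h4 := eq_mul_exp_primitive two_pi_nonneg (κ := κ x) (f := fun t =>
      F (IccExtend two_pi_nonneg (expCurve x (v x)) t ^ p * Real.cos t)
        (IccExtend two_pi_nonneg (expCurve x (v x)) t ^ q * Real.sin t)) (fun φ => by
      have := h2 φ
      rw [h1 φ, one_mul] at this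
      simpa only [IccExtend_val] using this) φ
    simp only [IccExtend_val, h3.2.1.1, Real.cos_zero, Real.sin_zero, mul_zero, mul_one] at h4
    exact h4
  let W : ℝ → C(Icc 0 (2 * Real.pi), ℝ) := fun x => NormedSpace.exp (v x) ^ s * Ψ x
  have hW : ContinuousAt W 0 := ((continuousAt_exp_comp h.continuousAt_exponent).pow _).mul hΨ
  have hWt : ∀ φ, Tendsto (fun x => W x φ) (𝓝[>] 0) (𝓝 (W 0 φ)) := fun φ =>
    ((ContinuousMap.evalCLM ℝ φ).continuous.continuousAt.comp hW).tendsto.mono_left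
      nhdsWithin_le_nhds
  have hFW : ∀ᶠ x in 𝓝[>] (0 : ℝ),
      F (x ^ p) 0 = x ^ s * W x ⟨0, left_mem_Icc.2 two_pi_nonneg⟩ := by
    filter_upwards [nhdsWithin_le_nhds hΨe, h.solution] with x h1 h2
    have e1 := h1 ⟨0, left_mem_Icc.2 two_pi_nonneg⟩
    have e2 : NormedSpace.exp (v x) ⟨0, left_mem_Icc.2 two_pi_nonneg⟩ = 1 := by
      rw [exp_apply, h2.1, Real.exp_zero]
    simp only [expCurve_apply, e2, mul_one, Real.cos_zero, Real.sin_zero, mul_zero] at e1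
    simp [W, e1, e2]
  -- In the limit `x → 0`, `W 0 φ` is `W 0` at `φ = 0` times an exponential. If `F_s` vanished at
  -- `(1, 0)` it would vanish on the whole circle.
  have hne : qhPart p q F s 1 0 ≠ 0 := by
    intro h0
    have hW0 : W 0 ⟨0, left_mem_Icc.2 two_pi_nonneg⟩ = 0 := by
      simp only [W, ContinuousMap.mul_apply, hΨ0, Real.cos_zero, Real.sin_zero, h0, mul_zero]
    have hWφ : ∀ φ, W 0 φ = 0 := by
      intro φ
      have e1 : Tendsto (fun x => W x ⟨0, left_mem_Icc.2 two_pi_nonneg⟩ *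
          Real.exp (primitive two_pi_nonneg (κ x) φ)) (𝓝[>] 0)
          (𝓝 (0 * Real.exp (primitive two_pi_nonneg (κ 0) φ))) := by
        refine (by simpa only [hW0] using hWt ⟨0, left_mem_Icc.2 two_pi_nonneg⟩ :
          Tendsto _ _ (𝓝 (0 : ℝ))).mul ((Real.continuous_exp.tendsto _).comp ?_)
        exact (((ContinuousMap.evalCLM ℝ φ).comp
          (primitive two_pi_nonneg)).continuous.continuousAt.comp
            hκ).tendsto.mono_left nhdsWithin_le_nhds
      rw [zero_mul] at e1
      refine tendsto_nhds_unique (hWt φ) (e1.congr' ?_)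
      filter_upwards [hexp, hFW, nhdsWithin_le_nhds hΨe, self_mem_nhdsWithin] with x h1 h2 h3 hx
      have hx' : x ^ s ≠ 0 := pow_ne_zero _ (ne_of_gt hx)
      have e2 := h1 φ
      rw [h3 φ, h2, expCurve_apply, mul_pow] at e2
      refine mul_left_cancel₀ hx' ?_
      simp only [W, ContinuousMap.mul_apply, ContinuousMap.pow_apply] at e2 ⊢
      linear_combination -e2
    obtain ⟨x, y, hxy⟩ := hF
    refine hxy (qhPart_eq_zero_of_Icc hp hq (fun t ht => ?_) x y)
    have e1 := hWφ ⟨t, ht⟩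
    simp only [W, ContinuousMap.mul_apply, ContinuousMap.pow_apply] at e1
    rw [← hΨ0 ⟨t, ht⟩]
    exact (mul_eq_zero.1 e1).resolve_left (pow_ne_zero _ (exp_apply_pos _ _).ne')
  refine ⟨hne, ?_⟩
  have hW0 : W 0 ⟨0, left_mem_Icc.2 two_pi_nonneg⟩ ≠ 0 := by
    simp only [W, ContinuousMap.mul_apply, hΨ0, Real.cos_zero, Real.sin_zero,
      ContinuousMap.pow_apply]
    exact mul_ne_zero (pow_ne_zero _ (exp_apply_pos _ _).ne') hne
  filter_upwards [hexp, hκe, hFW, (hWt _).eventually_ne hW0, self_mem_nhdsWithin]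
    with x h1 h2 h3 h4 hx
  have hx' : x ^ s ≠ 0 := pow_ne_zero _ (ne_of_gt hx)
  constructor
  · refine ContinuousOn.congr (f := IccExtend two_pi_nonneg (κ x))
      (κ x).continuous.Icc_extend'.continuousOn fun t ht => ?_
    simp only [IccExtend_of_mem _ _ ht]
    rw [h2 ⟨t, ht⟩, one_mul]
  · rw [integral_cofactor_eq (f := polarCofactor p q r P Q K) h2, one_mul]
    have e1 := h1 ⟨2 * Real.pi, right_mem_Icc.2 two_pi_nonneg⟩
    simp only [Real.cos_two_pi, Real.sin_two_pi, mul_one, mul_zero] at e1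
    rw [e1, mul_div_cancel_left₀, Real.log_exp]
    rw [h3]; exact mul_ne_zero hx' h4

/-- The power `x ^ (j - r)` comes out of the integral and the remaining factor is bounded as `x →
0⁺`. This converts the order of `K` into vanishing coefficients `β_i`. -/
theorem PolarFamily.integral_cofactor_le (hp : 0 < p) (hq : 0 < q)
    (h : PolarFamily p q r P Q v T)
    (hKa : AnalyticAt ℝ (fun z : ℝ × ℝ => K z.1 z.2) (0, 0)) {j : ℕ} (hj : StartsAt p q K j)
    (hrj : r ≤ j) :
    ∃ C : ℝ, ∀ᶠ x in 𝓝[>] (0 : ℝ), |∫ φ in (0 : ℝ)..(2 * Real.pi), polarCofactor p q r P Q K φ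
        (IccExtend two_pi_nonneg (expCurve x (v x)) φ)| ≤ C * x ^ (j - r) := by
  obtain ⟨κ, hκ, hκe⟩ := h.exists_cofactor_eq hp hq hKa hj hrj
  let I : C(Icc 0 (2 * Real.pi), ℝ) →L[ℝ] ℝ :=
    (ContinuousMap.evalCLM ℝ ⟨2 * Real.pi, right_mem_Icc.2 two_pi_nonneg⟩).comp
      (primitive two_pi_nonneg)
  have hI : Tendsto (fun x => |I (κ x)|) (𝓝[>] 0) (𝓝 |I (κ 0)|) :=
    ((I.continuous.continuousAt.comp hκ).abs.tendsto).mono_left nhdsWithin_le_nhds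
  refine ⟨|I (κ 0)| + 1, ?_⟩
  filter_upwards [hκe, hI.eventually (gt_mem_nhds (lt_add_one _)), self_mem_nhdsWithin]
    with x h1 h2 hx
  have hx' : 0 < x := hx
  rw [integral_cofactor_eq (f := polarCofactor p q r P Q K) h1, abs_mul,
    abs_of_pos (pow_pos hx' _), mul_comm]
  gcongr
  exact h2.le

end Family

/-! ### The Poincaré map and the logarithm of the quotient of values of `F`. -/

section Return

/-- The value at `2π` of the polar solution with initial value `x`. -/
noncomputable def polarReturn (p q r : ℕ) (P Q : ℝ → ℝ → ℝ) (x : ℝ) : ℝ :=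
  open Classical in
  if h : ∃ ρ, IsPolarSolution p q r P Q x ρ then h.choose (2 * Real.pi) else 0

lemma polarReturn_eq {p q r : ℕ} {P Q : ℝ → ℝ → ℝ} {x y : ℝ}
    (h : ∃ ρ, IsPolarSolution p q r P Q x ρ)
    (hy : ∀ ρ, IsPolarSolution p q r P Q x ρ → ρ (2 * Real.pi) = y) :
    polarReturn p q r P Q x = y := by
  rw [polarReturn, dif_pos h]
  exact hy _ h.choose_spec

/-- The logarithm of the quotient of the values of `F` at both ends of the polar solution with
initial value `x`. -/
noncomputable def logQuotient (p q r : ℕ) (P Q F : ℝ → ℝ → ℝ) (x : ℝ) : ℝ :=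
  Real.log (F (polarReturn p q r P Q x ^ p) 0 / F (x ^ p) 0)

variable {E : Type*} [NormedAddCommGroup E] [NormedSpace ℝ E]

lemma InMo.angular_ne_zero {p q r : ℕ} (hp : 0 < p) (hq : 0 < q) {P Q : ℝ → ℝ → ℝ}
    (h : InMo p q r P Q) {c s : ℝ} (hcs : c ^ 2 + s ^ 2 = 1) :
    p * c * qhPart p q Q (q + r) c s - q * s * qhPart p q P (p + r) c s ≠ 0 :=
  angular_ne_zero_of_isMonodromic hp hq (fun τ x y => qhPart_homogeneous p q P _ τ x y)
    (fun τ x y => qhPart_homogeneous p q Q _ τ x y)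
    (contDiff_iff_contDiffAt.2 fun z => (analyticAt_qhPart p q P _ z).contDiffAt)
    (contDiff_iff_contDiffAt.2 fun z => (analyticAt_qhPart p q Q _ z).contDiffAt) h.monodromic hcs

/-- The polar solutions of a family of vector fields in the monodromic class. -/
theorem exists_polarFamily [CompleteSpace E] {p q : ℕ} (hp : 0 < p) (hq : 0 < q) (r : ℕ)
    {P Q : E → ℝ → ℝ → ℝ} {a : E}
    (hP : AnalyticAt ℝ (fun z : ℝ × ℝ × E => P z.2.2 z.1 z.2.1) (0, 0, a))
    (hQ : AnalyticAt ℝ (fun z : ℝ × ℝ × E => Q z.2.2 z.1 z.2.1) (0, 0, a))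
    (hMo : InMo p q r (P a) (Q a)) :
    ∃ V : ℝ × E → C(Icc 0 (2 * Real.pi), ℝ), AnalyticAt ℝ V (0, a) ∧
      (∀ᶠ z in 𝓝 ((0 : ℝ), a), 0 < z.1 →
        polarReturn p q r (truncation p q (p + r) (P z.2)) (truncation p q (q + r) (Q z.2)) z.1
          = expCurve z.1 (V z) ⟨2 * Real.pi, right_mem_Icc.2 two_pi_nonneg⟩) ∧
      (∃ T, PolarFamily p q r (P a) (Q a) (fun x => V (x, a)) T) ∧
      ∀ᶠ x in 𝓝[>] (0 : ℝ), ∀ ρ, IsPolarSolution p q r (P a) (Q a) x ρ →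
        ∀ φ : Icc 0 (2 * Real.pi), ρ φ = expCurve x (V (x, a)) φ := by
  obtain ⟨G, ϑ, hG, hϑ, hϑ0, hfield⟩ := exists_polar_field hp hq r hP hQ
    fun c s hcs => hMo.angular_ne_zero hp hq hcs
  obtain ⟨V, hV, hpos, hVe⟩ := exists_polar_flow (p := p) (q := q) (r := r)
    (P := fun b => truncation p q (p + r) (P b)) (Q := fun b => truncation p q (q + r) (Q b))
    hG hfield
  have hslice : Tendsto (fun x : ℝ => (x, a)) (𝓝 0) (𝓝 (0, a)) :=
    Continuous.tendsto' (by fun_prop) _ _ rfl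
  have hVc : ContinuousAt (fun x => V (x, a)) 0 := 
    ContinuousAt.comp (g := V) (f := fun x : ℝ => (x, a)) hV.continuousAt (by fun_prop)
  have hut : Tendsto (fun x => (expCurve x (V (x, a)), a)) (𝓝 0) (𝓝 (0, a)) :=
    (tendsto_smul_exp hVc).prodMk_nhds tendsto_const_nhds
  have hPa := truncation_of_startsAt hMo.startsAt_fst
  have hQa := truncation_of_startsAt hMo.startsAt_snd
  refine ⟨V, hV, ?_, ⟨fun x => ϑ (expCurve x (V (x, a)), a), hVc, ?_, ?_, ?_⟩, ?_⟩
  · filter_upwards [hVe] with z hz hz0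
    obtain ⟨-, hz⟩ := hz
    exact polarReturn_eq ⟨_, (hz hz0).1⟩ fun ρ hρ =>
      (hz hz0).2 ρ hρ ⟨2 * Real.pi, right_mem_Icc.2 two_pi_nonneg⟩
  · have := hϑ.continuousAt.tendsto.comp hut
    simpa [ContinuousAt, Function.comp_def, expCurve] using this
  · intro φ
    simpa [expCurve] using hϑ0 φ
  · filter_upwards [nhdsWithin_le_nhds (hslice.eventually hVe),
      nhdsWithin_le_nhds (hut.eventually hfield), self_mem_nhdsWithin] with x h1 h2 hx
    obtain ⟨h0, h1⟩ := h1
    have h3 := (h1 hx).1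
    simp only [hPa, hQa] at h2 h3
    exact ⟨h0, h3, fun φ => (h2 φ (hpos (x, a) hx φ)).1⟩
  · filter_upwards [nhdsWithin_le_nhds (hslice.eventually hVe), self_mem_nhdsWithin]
      with x h1 hx ρ hρ φ
    refine (h1.2 hx).2 ρ ?_ φ
    simp only [hPa, hQa]
    exact hρ

/-- The base point is `η₁ - 1` at the given parameter, which need not be zero. Away from zero the
quotient by `z ^ 2` is analytic; at zero it is a second order Taylor remainder. -/
lemma exists_log_one_add {z₀ : ℝ} (hz₀ : 0 < 1 + z₀) :
    ∃ m : ℝ → ℝ, AnalyticAt ℝ m z₀ ∧ ∀ᶠ z in 𝓝 z₀, Real.log (1 + z) = z + z ^ 2 * m z := by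
  have hlog : AnalyticAt ℝ (fun z => Real.log (1 + z)) z₀ :=
    (analyticAt_const.add analyticAt_id).log hz₀
  by_cases h : z₀ = 0
  · subst h
    have h1 : AnalyticAt ℝ (fun z : ℝ × ℝ => Real.log (1 + z.1)) (0, 0) :=
      AnalyticAt.comp (g := fun z => Real.log (1 + z)) (f := Prod.fst) hlog analyticAt_fst
    obtain ⟨g, hg, he⟩ := exists_taylor_remainder h1 2
    refine ⟨fun z => g (z, 0), hg.fst_slice, ?_⟩
    have hslice : Tendsto (fun x : ℝ => (x, (0 : ℝ))) (𝓝 0) (𝓝 (0, 0)) :=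
      Continuous.tendsto' (by fun_prop) _ _ rfl
    have hd : deriv (fun x : ℝ => Real.log (1 + x)) 0 = 1 := by
      have := (((hasDerivAt_id (0 : ℝ)).const_add 1).log (by simp)).deriv
      simpa using this
    filter_upwards [hslice.eventually he] with z hz
    rw [hz]
    simp [Finset.sum_range_succ, parCoeff, hd]
  · refine ⟨fun z => (Real.log (1 + z) - z) / z ^ 2,
      (hlog.sub analyticAt_id).div (analyticAt_id.pow 2) (pow_ne_zero _ h), ?_⟩
    filter_upwards [eventually_ne_nhds h] with z hz
    field_simp
    ring

/-- The difference of the values of an analytic function, as a multiple of the increment. -/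
lemma exists_sub_eq_mul {M : ℝ × E → ℝ} {a : E} (hM : AnalyticAt ℝ M (0, a)) :
    ∃ h : ℝ × ℝ × E → ℝ, AnalyticAt ℝ h (0, 0, a) ∧ ∀ᶠ w in 𝓝 ((0 : ℝ), (0 : ℝ), a),
      M (w.2.1 + w.1, w.2.2) - M (w.2.1, w.2.2) = w.1 * h w := by
  have h1 : AnalyticAt ℝ (fun w : ℝ × ℝ × E => M (w.2.1 + w.1, w.2.2)) (0, 0, a) := by
    refine AnalyticAt.comp (g := M) (f := fun w : ℝ × ℝ × E => (w.2.1 + w.1, w.2.2)) ?_ ?_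
    · simpa using hM
    · exact ((analyticAt_fst.comp analyticAt_snd).add analyticAt_fst).prod
        (analyticAt_snd.comp analyticAt_snd)
  obtain ⟨h, hh, he⟩ := exists_analyticAt_eq_add_mul h1
  refine ⟨h, hh, he.mono fun w hw => ?_⟩
  simp only [add_zero] at hw
  rw [hw]; ring

/-- Values on the positive horizontal axis of a function without components of small degree. -/
lemma exists_axis_expansion {p q : ℕ} (hp : 0 < p) (hq : 0 < q) (n : ℕ) {f : E → ℝ → ℝ → ℝ} {a : E}
    (hf : AnalyticAt ℝ (fun z : ℝ × ℝ × E => f z.2.2 z.1 z.2.1) (0, 0, a)) :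
    ∃ g : ℝ × E → ℝ, AnalyticAt ℝ g (0, a) ∧ g (0, a) = qhPart p q (f a) n 1 0 ∧
      ∀ᶠ z in 𝓝 ((0 : ℝ), a), truncation p q n (f z.2) (z.1 ^ p) 0 = z.1 ^ n * g z := by
  -- On a one-point space with `c = 1`, `s = 0`, the blow-up is the restriction to the positive
  -- horizontal axis.
  obtain ⟨Φ, hΦ, hΦ0, hΦe⟩ := exists_blowup (T := Unit) hp hq n hf 1 0
  let j : ℝ × E → C(Unit, ℝ) × E := fun z => (z.1 • 1, z.2)
  have hj : AnalyticAt ℝ j (0, a) :=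
    (analyticAt_fst.fun_smul analyticAt_const).prod analyticAt_snd
  have hj0 : j (0, a) = (0, a) := by simp [j]
  refine ⟨fun z => Φ (j z) (), ?_, ?_, ?_⟩
  · refine ((ContinuousMap.evalCLM ℝ ()).analyticAt _).comp
      (AnalyticAt.comp (g := Φ) (by rwa [hj0]) hj)
  · simp [hj0, hΦ0]
  · have := hj.continuousAt.tendsto
    rw [hj0] at this
    filter_upwards [this.eventually hΦe] with z hz
    simpa [j] using hz ()

/-- Expansion of the logarithm of the quotient of the values of `F` at both ends of the polar
solutions, in terms of the displacement `Z = Π / x - 1`. -/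
theorem exists_logQuotient_expansion {p q r s : ℕ} (hp : 0 < p) (hq : 0 < q)
    {P Q F : E → ℝ → ℝ → ℝ} {a : E}
    (hF : AnalyticAt ℝ (fun z : ℝ × ℝ × E => F z.2.2 z.1 z.2.1) (0, 0, a))
    (hFs : qhPart p q (F a) s 1 0 ≠ 0)
    {Z : ℝ × E → ℝ} (hZ : AnalyticAt ℝ Z (0, a)) (hZ0 : 0 < 1 + Z (0, a))
    (hZe : ∀ᶠ z in 𝓝 ((0 : ℝ), a), 0 < z.1 → polarReturn p q r (P z.2) (Q z.2) z.1
      = z.1 * (1 + Z z)) :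
    ∃ (Y : ℝ × E → ℝ) (y : E → ℝ), AnalyticAt ℝ Y (0, a) ∧ AnalyticAt ℝ y a ∧
      (∀ᶠ z in 𝓝 ((0 : ℝ), a), 0 < z.1 →
        logQuotient p q r (P z.2) (Q z.2) (truncation p q s (F z.2)) z.1 = s * Z z + Z z * Y z) ∧
      ∀ᶠ b in 𝓝 a, Y (0, b) = Z (0, b) * y b ∧
        s * Z (0, b) + Z (0, b) * Y (0, b) = s * Real.log (1 + Z (0, b)) := by
  obtain ⟨m, hm, hme⟩ := exists_log_one_add hZ0
  obtain ⟨g, hg, hg0, hge⟩ := exists_axis_expansion hp hq s hF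
  rw [← hg0] at hFs
  -- Dividing by `g (0, a)`, whose sign is unknown, makes the argument of the logarithm positive
  -- near `(0, a)` and does not change quotients of values of `g`.
  let M : ℝ × E → ℝ := fun z => Real.log (g z / g (0, a))
  have hM : AnalyticAt ℝ M (0, a) :=
    AnalyticAt.comp (g := Real.log) (f := fun z => g z / g (0, a))
      (analyticAt_id.log (by rw [div_self hFs]; exact one_pos)) (hg.div analyticAt_const hFs)
  obtain ⟨h, hh, hhe⟩ := exists_sub_eq_mul hM
  let w : ℝ × E → ℝ × ℝ × E := fun z => (z.1 * Z z, z.1, z.2)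
  have hw : AnalyticAt ℝ w (0, a) :=
    (analyticAt_fst.mul hZ).prod (analyticAt_fst.prod analyticAt_snd)
  have hw0 : w (0, a) = (0, 0, a) := by simp [w]
  have hmZ : AnalyticAt ℝ (fun z => m (Z z)) (0, a) := AnalyticAt.comp (g := m) hm hZ
  have hhw : AnalyticAt ℝ (fun z => h (w z)) (0, a) :=
    AnalyticAt.comp (g := h) (by rwa [hw0]) hw
  have hslice : AnalyticAt ℝ (fun b : E => ((0 : ℝ), b)) a := analyticAt_const.prod analyticAt_id
  -- The logarithm is `s log (1 + Z) + M(x + x Z) - M(x)`. The first part is `s Z + s Z² m(Z)` and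
  -- the increment of `M` is `x Z h`; what multiplies `Z` besides `s` is `Y`, and its second summand
  -- disappears at `x = 0`.
  refine ⟨fun z => s * Z z * m (Z z) + z.1 * h (w z), fun b => s * m (Z (0, b)),
    ((analyticAt_const.mul hZ).mul hmZ).add (analyticAt_fst.mul hhw),
    analyticAt_const.mul (AnalyticAt.comp (g := fun z => m (Z z)) hmZ hslice), ?_, ?_⟩
  · have hret : AnalyticAt ℝ (fun z : ℝ × E => (z.1 * (1 + Z z), z.2)) (0, a) :=
      (analyticAt_fst.mul (analyticAt_const.add hZ)).prod analyticAt_snd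
    have hrett : Tendsto (fun z : ℝ × E => (z.1 * (1 + Z z), z.2)) (𝓝 (0, a)) (𝓝 (0, a)) := by
      simpa [ContinuousAt] using hret.continuousAt
    have hwt : Tendsto w (𝓝 (0, a)) (𝓝 (0, 0, a)) := by
      have := hw.continuousAt.tendsto
      rwa [hw0] at this
    have hpos : ∀ᶠ z in 𝓝 ((0 : ℝ), a), 0 < g z / g (0, a) :=
      (hg.div analyticAt_const hFs).continuousAt.eventually
        (lt_mem_nhds (by simp [hFs]))
    have hZpos : ∀ᶠ z in 𝓝 ((0 : ℝ), a), 0 < 1 + Z z :=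
      (analyticAt_const.add hZ).continuousAt.eventually (lt_mem_nhds hZ0)
    filter_upwards [hZe, hge, hrett.eventually hge, hpos, hrett.eventually hpos, hZpos,
      hwt.eventually hhe, hZ.continuousAt.eventually hme] with z h1 h2 h3 h4 h5 h6 h7 h8 hz
    rw [logQuotient, h1 hz, h2, h3]
    have e1 : (z.1 * (1 + Z z)) ^ s * g (z.1 * (1 + Z z), z.2) / (z.1 ^ s * g z)
        = (1 + Z z) ^ s * ((g (z.1 * (1 + Z z), z.2) / g (0, a)) / (g z / g (0, a))) := by
      have e2 : g z ≠ 0 := fun h0 => by rw [h0, zero_div] at h4; exact lt_irrefl _ h4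
      rw [mul_pow]
      field_simp
    rw [e1, Real.log_mul (pow_ne_zero _ h6.ne') (div_ne_zero h5.ne' h4.ne'), Real.log_pow,
      Real.log_div h5.ne' h4.ne', h8]
    have e3 : z.1 + z.1 * Z z = z.1 * (1 + Z z) := by ring
    simp only [w, e3, M] at h7
    simp only [w]
    linear_combination h7
  · have hZt : Tendsto (fun b : E => Z (0, b)) (𝓝 a) (𝓝 (Z (0, a))) :=
      (AnalyticAt.comp (g := Z) hZ hslice).continuousAt.tendsto
    filter_upwards [hZt.eventually hme] with b hb
    constructor
    · ring
    · rw [hb]; ring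

end Return

/-! ### Ideals of germs and the triangular relations between coefficients. -/

section Germs

variable {m : ℕ} {Λ : Set (EuclideanSpace ℝ (Fin m))} {a : EuclideanSpace ℝ (Fin m)}

/-- The germ of an analytic function. -/
def mkGerm (Λ : Set (EuclideanSpace ℝ (Fin m))) {f : EuclideanSpace ℝ (Fin m) → ℝ}
    (hf : AnalyticAt ℝ f a) : analyticGerms Λ a := ⟨(f : (𝓝[Λ] a).Germ ℝ), f, hf, rfl⟩

/-- The analytic functions whose germs belong to the ideal `I`. -/
def GermMem (I : Ideal (analyticGerms Λ a)) (f : EuclideanSpace ℝ (Fin m) → ℝ) : Prop :=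
  ∃ hf : AnalyticAt ℝ f a, mkGerm Λ hf ∈ I

lemma GermMem.add {I : Ideal (analyticGerms Λ a)} {f g : EuclideanSpace ℝ (Fin m) → ℝ}
    (hf : GermMem I f) (hg : GermMem I g) : GermMem I (fun b => f b + g b) :=
  ⟨hf.1.add hg.1, I.add_mem hf.2 hg.2⟩

lemma GermMem.mul {I : Ideal (analyticGerms Λ a)} {f g : EuclideanSpace ℝ (Fin m) → ℝ}
    (hf : GermMem I f) (hg : AnalyticAt ℝ g a) : GermMem I (fun b => f b * g b) :=
  ⟨hf.1.mul hg, I.mul_mem_right (mkGerm Λ hg) hf.2⟩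

/-- Germs are taken along `Λ`, so vanishing on `Λ` near `a` is enough. This discards the
displacement coefficients that vanish on `Λ` but perhaps not around it. -/
lemma germMem_of_eventually_eq_zero {I : Ideal (analyticGerms Λ a)}
    {f : EuclideanSpace ℝ (Fin m) → ℝ} (hf : AnalyticAt ℝ f a) (h : ∀ᶠ b in 𝓝[Λ] a, f b = 0) :
    GermMem I f := by
  refine ⟨hf, ?_⟩
  have : mkGerm Λ hf = 0 := Subtype.ext (Germ.coe_eq.2 h)
  rw [this]; exact I.zero_mem

lemma GermMem.sum {I : Ideal (analyticGerms Λ a)} {ι : Type*} {t : Finset ι}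
    {f : ι → EuclideanSpace ℝ (Fin m) → ℝ} (hf : ∀ j ∈ t, GermMem I (f j)) :
    GermMem I (fun b => ∑ j ∈ t, f j b) := by
  classical
  induction t using Finset.induction_on with
  | empty =>
    refine germMem_of_eventually_eq_zero (by simpa using analyticAt_const) (by simp)
  | insert i t hi ih =>
    have := (hf i (Finset.mem_insert_self i t)).add
      (ih fun j hj => hf j (Finset.mem_insert_of_mem hj))
    simpa only [Finset.sum_insert hi] using this

/-- The ideal of germs generated by a set of functions. -/
def germIdeal (Λ : Set (EuclideanSpace ℝ (Fin m))) (a : EuclideanSpace ℝ (Fin m))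
    (S : Set (EuclideanSpace ℝ (Fin m) → ℝ)) : Ideal (analyticGerms Λ a) :=
  Ideal.span {u : analyticGerms Λ a | ∃ v ∈ S, (u : (𝓝[Λ] a).Germ ℝ) = (v : (𝓝[Λ] a).Germ ℝ)}

lemma germMem_of_mem {S : Set (EuclideanSpace ℝ (Fin m) → ℝ)}
    {f : EuclideanSpace ℝ (Fin m) → ℝ} (hf : AnalyticAt ℝ f a) (h : f ∈ S) :
    GermMem (germIdeal Λ a S) f :=
  ⟨hf, Ideal.subset_span ⟨f, h, rfl⟩⟩

lemma GermMem.germCongr {S : Set (EuclideanSpace ℝ (Fin m) → ℝ)}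
    {f g h : EuclideanSpace ℝ (Fin m) → ℝ} (hh : GermMem (germIdeal Λ a S) h)
    (he : ∀ᶠ b in 𝓝[Λ] a, h b = f b - g b) : GermCongr Λ a S f g :=
  ⟨mkGerm Λ hh.1, Germ.coe_eq.2 he, hh.2⟩

/-- The displacement coefficients: `η₁ - 1, η₂, η₃, …`. -/
def displacement {X : Type*} (η : ℕ → X → ℝ) : ℕ → X → ℝ
  | 0 => fun b => η 1 b - 1
  | j + 1 => η (j + 2)

/-- Congruences modulo displacement coefficients. -/
theorem germCongr_of_expansion {s : ℕ} {η β c : ℕ → EuclideanSpace ℝ (Fin m) → ℝ}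
    {y : EuclideanSpace ℝ (Fin m) → ℝ} (hη : ∀ i, AnalyticAt ℝ (η i) a)
    (hc : ∀ i, AnalyticAt ℝ (c i) a) (hy : AnalyticAt ℝ y a) {i : ℕ} (hi : 0 < i)
    (he : ∀ᶠ b in 𝓝 a, β i b = s * displacement η i b
      + ∑ j ∈ Finset.range (i + 1), displacement η j b * c (i - j) b)
    (hc0 : ∀ᶠ b in 𝓝 a, c 0 b = displacement η 0 b * y b)
    {S : Set (EuclideanSpace ℝ (Fin m) → ℝ)}
    (hS : ∀ j < i, displacement η j ∈ S ∨ ∀ᶠ b in 𝓝[Λ] a, displacement η j b = 0) :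
    GermCongr Λ a S (β i) (fun b => s * η (i + 1) b) := by
  have hd : ∀ j, AnalyticAt ℝ (displacement η j) a := by
    rintro (_ | j)
    · exact (hη 1).sub analyticAt_const
    · exact hη _
  have hmem : ∀ j < i, GermMem (germIdeal Λ a S) (displacement η j) := by
    intro j hj
    rcases hS j hj with h | h
    · exact germMem_of_mem (hd j) h
    · exact germMem_of_eventually_eq_zero (hd j) h
  -- The only term of the sum not visibly in the ideal is the last one, `d_i c₀`; since `c₀ = d₀ y`
  -- and `i > 0`, it is a multiple of `d₀`, which lies in the ideal.
  have h1 : GermMem (germIdeal Λ a S) (fun b =>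
      ∑ j ∈ Finset.range i, displacement η j b * c (i - j) b
        + displacement η 0 b * (y b * displacement η i b)) :=
    (GermMem.sum fun j hj => (hmem j (Finset.mem_range.1 hj)).mul (hc (i - j))).add
      ((hmem 0 hi).mul (hy.mul (hd i)))
  refine h1.germCongr (nhdsWithin_le_nhds ?_)
  filter_upwards [he, hc0] with b hb hb0
  rw [hb, Finset.sum_range_succ, Nat.sub_self, hb0]
  obtain ⟨k, rfl⟩ := Nat.exists_eq_succ_of_ne_zero hi.ne'
  have : displacement η (k + 1) b = η (k + 1 + 1) b := rfl
  rw [this]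
  ring

/-- If the first coefficients `β` vanish, then so do the first displacement coefficients. -/
theorem displacement_eq_zero {X : Type*} {s n : ℕ} (hs : 0 < s) {η β c : ℕ → X → ℝ} {b : X} {y : ℝ}
    (hη : 0 < η 1 b)
    (he : ∀ i, β i b = s * displacement η i b
      + ∑ j ∈ Finset.range (i + 1), displacement η j b * c (i - j) b)
    (hc0 : c 0 b = displacement η 0 b * y) (hβ0 : β 0 b = s * Real.log (η 1 b))
    (hβ : ∀ i < n, β i b = 0) :
    (∀ i < n, displacement η i b = 0) ∧ (0 < n → β n b = s * displacement η n b) := by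
  have hs' : (s : ℝ) ≠ 0 := by exact_mod_cast hs.ne'
  -- The index `0` needs the logarithm: the relation `0 = s d₀ + d₀² y` alone would also allow
  -- nonzero solutions.
  have hd0 : 0 < n → displacement η 0 b = 0 := by
    intro hn
    have h1 := hβ 0 hn
    rw [hβ0, mul_eq_zero, or_iff_right hs'] at h1
    have h2 := Real.eq_one_of_pos_of_log_eq_zero hη h1
    simp [displacement, h2]
  have hstep : ∀ i, 0 < n → (∀ j < i, displacement η j b = 0) → β i b = s * displacement η i b := by
    intro i hn hj
    rw [he, Finset.sum_eq_zero, add_zero]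
    intro j hj'
    rcases Nat.lt_succ_iff_lt_or_eq.1 (Finset.mem_range.1 hj') with h | rfl
    · rw [hj j h, zero_mul]
    · rw [Nat.sub_self, hc0, hd0 hn, zero_mul, mul_zero]
  have hz : ∀ i < n, displacement η i b = 0 := by
    intro i
    induction i using Nat.strong_induction_on with
    | _ i ih =>
      intro hi
      have h1 := hstep i (by omega) fun j hj => ih j hj (hj.trans hi)
      rw [hβ i hi] at h1
      exact (mul_eq_zero.1 h1.symm).resolve_left hs'
  exact ⟨hz, fun hn => hstep n hn hz⟩

/-- Once the lower coefficients vanish, dividing by `x ^ i` and letting `x → 0⁺` bounds the next one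
by the limit of `C x ^ (n - i)`, which is zero. -/
lemma parCoeff_eq_zero_of_le {E : Type*} [NormedAddCommGroup E] [NormedSpace ℝ E]
    {f : ℝ × E → ℝ} {b : E} (hf : AnalyticAt ℝ f (0, b)) {n : ℕ} {C : ℝ}
    (h : ∀ᶠ x in 𝓝[>] (0 : ℝ), |f (x, b)| ≤ C * x ^ n) : ∀ i < n, parCoeff i f b = 0 := by
  intro i
  induction i using Nat.strong_induction_on with
  | _ i ih =>
    intro hi
    obtain ⟨g, hg, he⟩ := exists_taylor_remainder hf (i + 1)
    have hslice : Tendsto (fun x : ℝ => (x, b)) (𝓝 0) (𝓝 (0, b)) :=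
      Continuous.tendsto' (by fun_prop) _ _ rfl
    have hgt : Tendsto (fun x : ℝ => g (x, b)) (𝓝 0) (𝓝 (g (0, b))) :=
      hg.fst_slice.continuousAt.tendsto
    have h1 : Tendsto (fun x : ℝ => |parCoeff i f b + x * g (x, b)|) (𝓝[>] 0)
        (𝓝 |parCoeff i f b + 0 * g (0, b)|) :=
      ((tendsto_const_nhds.add (tendsto_id.mul hgt)).abs).mono_left nhdsWithin_le_nhds
    have h2 : Tendsto (fun x : ℝ => C * x ^ (n - i)) (𝓝[>] 0) (𝓝 0) := by
      have : Continuous fun x : ℝ => C * x ^ (n - i) := by fun_prop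
      refine (this.tendsto' 0 0 ?_).mono_left nhdsWithin_le_nhds
      rw [zero_pow (by omega), mul_zero]
    have h3 : |parCoeff i f b + 0 * g (0, b)| ≤ 0 := by
      refine le_of_tendsto_of_tendsto h1 h2 ?_
      filter_upwards [h, nhdsWithin_le_nhds (hslice.eventually he), self_mem_nhdsWithin]
        with x hx1 hx2 hx
      have hx' : 0 < x := hx
      rw [hx2, Finset.sum_range_succ, Finset.sum_eq_zero fun j hj => by
        rw [ih j (Finset.mem_range.1 hj) ((Finset.mem_range.1 hj).trans hi), mul_zero],
        show (0 + x ^ i * parCoeff i f b + x ^ (i + 1) * g (x, b))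
          = x ^ i * (parCoeff i f b + x * g (x, b)) by ring, abs_mul,
        abs_of_pos (pow_pos hx' i), show n = i + (n - i) by omega, pow_add] at hx1
      have h4 : 0 < x ^ i := pow_pos hx' i
      refine le_of_mul_le_mul_left ?_ h4
      linarith
    rw [zero_mul, add_zero] at h3
    exact abs_nonpos_iff.1 h3

end Germs

/-! ### Coefficients of the Poincaré map and of the cofactor integral. -/

section Assembly

variable {E : Type*} [NormedAddCommGroup E] [NormedSpace ℝ E]

/-- The coefficients of the expansion of the Poincaré map. -/
noncomputable def returnCoeff (p q r : ℕ) (P Q : E → ℝ → ℝ → ℝ) (i : ℕ) (b : E) : ℝ :=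
  rightCoeff (polarReturn p q r (truncation p q (p + r) (P b)) (truncation p q (q + r) (Q b))) i

/-- The coefficients of the expansion of the integral of the cofactor of `F`. -/
noncomputable def cofactorCoeff (p q r s : ℕ) (P Q F : E → ℝ → ℝ → ℝ) (i : ℕ) (b : E) : ℝ :=
  rightCoeff (logQuotient p q r (truncation p q (p + r) (P b)) (truncation p q (q + r) (Q b))
    (truncation p q s (F b))) i

/-- A local analytic model near one parameter computes the globally defined coefficients at all
nearby parameters, for all indices at once; this is what makes them analytic in the parameter. -/
lemma eventually_rightCoeff_eq {f : E → ℝ → ℝ} {g : ℝ × E → ℝ} {a : E} (hg : AnalyticAt ℝ g (0, a))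
    (h : ∀ᶠ z in 𝓝 ((0 : ℝ), a), 0 < z.1 → f z.2 z.1 = g z) :
    ∀ᶠ b in 𝓝 a, ∀ i, rightCoeff (f b) i = parCoeff i g b := by
  filter_upwards [eventually_slice h, eventually_slice hg.eventually_analyticAt] with b hb hgb i
  refine rightCoeff_eq hgb.self_of_nhds.fst_slice ?_ i
  filter_upwards [nhdsWithin_le_nhds hb, self_mem_nhdsWithin] with x hx hx0
  exact hx hx0

/-- A component of degree `0` is the constant `f 0 0`. Positivity of `s` is needed to solve `s d_i =
0`. -/
lemma pos_of_apply_zero_eq_zero {p q s : ℕ} {f : ℝ → ℝ → ℝ} (h0 : f 0 0 = 0)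
    (hs : ∃ x y, qhPart p q f s x y ≠ 0) : 0 < s := by
  rcases Nat.eq_zero_or_pos s with rfl | h
  · obtain ⟨x, y, hxy⟩ := hs
    refine absurd ?_ hxy
    refine Finset.sum_eq_zero fun ab hab => ?_
    have h1 := Finset.mem_product.1 (Finset.mem_filter.1 hab).1
    simp only [zero_add, Finset.mem_range, Nat.lt_one_iff] at h1
    simp [h1.1, h1.2, taylorCoeff, h0]
  · exact h

/-- The expansions of the Poincaré map and of the integral of the cofactor, near one value of the
parameters. -/
theorem exists_coefficients [CompleteSpace E] {p q r s : ℕ} (hp : 0 < p) (hq : 0 < q)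
    {P Q F : E → ℝ → ℝ → ℝ} {a : E}
    (hP : AnalyticAt ℝ (fun z : ℝ × ℝ × E => P z.2.2 z.1 z.2.1) (0, 0, a))
    (hQ : AnalyticAt ℝ (fun z : ℝ × ℝ × E => Q z.2.2 z.1 z.2.1) (0, 0, a))
    (hMo : InMo p q r (P a) (Q a))
    (hF : AnalyticAt ℝ (fun z : ℝ × ℝ × E => F z.2.2 z.1 z.2.1) (0, 0, a))
    (hFs : StartsAt p q (F a) s) (hFn : ∃ x y, qhPart p q (F a) s x y ≠ 0)
    {K : ℝ → ℝ → ℝ} (hK : IsCofactor (P a) (Q a) (F a) K) :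
    StartsAt p q K r ∧
    (∀ i, AnalyticAt ℝ (returnCoeff p q r P Q i) a ∧
      AnalyticAt ℝ (cofactorCoeff p q r s P Q F i) a) ∧
    0 < returnCoeff p q r P Q 1 a ∧
    (∀ᶠ x in 𝓝[>] (0 : ℝ), (∃ ρ, IsPolarSolution p q r (P a) (Q a) x ρ) ∧
      ∀ ρ, IsPolarSolution p q r (P a) (Q a) x ρ →
        ContinuousOn (fun φ => polarCofactor p q r (P a) (Q a) K φ (ρ φ)) (Icc 0 (2 * Real.pi)) ∧
        HasSum (fun i => cofactorCoeff p q r s P Q F i a * x ^ i)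
          (∫ φ in (0 : ℝ)..(2 * Real.pi), polarCofactor p q r (P a) (Q a) K φ (ρ φ)) ∧
        HasSum (fun i => returnCoeff p q r P Q (i + 1) a * x ^ (i + 1)) (ρ (2 * Real.pi))) ∧
    (∀ n, r ≤ n → StartsAt p q K n → ∀ i < n - r, cofactorCoeff p q r s P Q F i a = 0) ∧
    ∃ (c : ℕ → E → ℝ) (y : E → ℝ), (∀ i, AnalyticAt ℝ (c i) a) ∧ AnalyticAt ℝ y a ∧
      ∀ᶠ b in 𝓝 a,
        (∀ i, cofactorCoeff p q r s P Q F i b = s * displacement (returnCoeff p q r P Q) i b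
          + ∑ j ∈ Finset.range (i + 1), displacement (returnCoeff p q r P Q) j b * c (i - j) b) ∧
        c 0 b = displacement (returnCoeff p q r P Q) 0 b * y b ∧
        cofactorCoeff p q r s P Q F 0 b = s * Real.log (returnCoeff p q r P Q 1 b) := by
  obtain ⟨V, hV, hVe, ⟨T, hT⟩, hVu⟩ := exists_polarFamily hp hq r hP hQ hMo
  let e : Icc 0 (2 * Real.pi) := ⟨2 * Real.pi, right_mem_Icc.2 two_pi_nonneg⟩
  -- `Z = Π / x - 1` for small `x > 0`, but defined and analytic also at `x = 0`.
  let Z : ℝ × E → ℝ := fun z => Real.exp (V z e) - 1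
  have hZ : AnalyticAt ℝ Z (0, a) := by
    refine (AnalyticAt.comp (g := Real.exp) (f := fun z => V z e) analyticAt_rexp ?_).sub
      analyticAt_const
    exact ((ContinuousMap.evalCLM ℝ e).analyticAt _).comp hV
  have hZ1 : ∀ z, 1 + Z z = Real.exp (V z e) := fun z => by simp [Z]
  have hZ0 : 0 < 1 + Z (0, a) := by rw [hZ1]; exact Real.exp_pos _
  have hexp : ∀ z : ℝ × E, expCurve z.1 (V z) e = z.1 * (1 + Z z) := fun z => by
    rw [expCurve_apply, exp_apply, hZ1]
  have hret : ∀ᶠ z in 𝓝 ((0 : ℝ), a), 0 < z.1 →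
      polarReturn p q r (truncation p q (p + r) (P z.2)) (truncation p q (q + r) (Q z.2)) z.1
        = z.1 * (1 + Z z) := by
    filter_upwards [hVe] with z hz hz0
    rw [hz hz0, hexp]
  obtain ⟨hF1, hint⟩ := hT.integral_cofactor hp hq hK hFs hFn
  obtain ⟨Y, y, hY, hy, hYe, hY0⟩ := exists_logQuotient_expansion
    (P := fun b => truncation p q (p + r) (P b)) (Q := fun b => truncation p q (q + r) (Q b))
    hp hq hF hF1 hZ hZ0 hret
  have h1Z : AnalyticAt ℝ (fun z => 1 + Z z) (0, a) := analyticAt_const.add hZ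
  have hB : AnalyticAt ℝ (fun z => s * Z z + Z z * Y z) (0, a) :=
    (analyticAt_const.mul hZ).add (hZ.mul hY)
  have hη : ∀ᶠ b in 𝓝 a, ∀ i, returnCoeff p q r P Q i b
      = parCoeff i (fun z => z.1 * (1 + Z z)) b :=
    eventually_rightCoeff_eq (analyticAt_fst.mul h1Z) hret
  have hβ : ∀ᶠ b in 𝓝 a, ∀ i, cofactorCoeff p q r s P Q F i b
      = parCoeff i (fun z => s * Z z + Z z * Y z) b := eventually_rightCoeff_eq hB hYe
  have hηs : ∀ᶠ b in 𝓝 a, ∀ i, returnCoeff p q r P Q (i + 1) b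
      = parCoeff i (fun z => 1 + Z z) b := by
    filter_upwards [hη, eventually_slice h1Z.eventually_analyticAt] with b hb hb1 i
    rw [hb, parCoeff_succ_fst_mul hb1.self_of_nhds]
  have hη1 : ∀ᶠ b in 𝓝 a, returnCoeff p q r P Q 1 b = 1 + Z (0, b) := by
    filter_upwards [hηs] with b hb
    rw [hb 0, parCoeff_zero]
  -- Passing from `Π = x (1 + Z)` to `Z` shifts the index by one and subtracts `1` from the constant
  -- term only.
  have hd : ∀ᶠ b in 𝓝 a, ∀ i, displacement (returnCoeff p q r P Q) i b = parCoeff i Z b := by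
    filter_upwards [hηs, hη1] with b hb hb1 i
    rcases i with _ | i
    · simp [displacement, hb1, parCoeff_zero]
    · exact (hb (i + 1)).trans (parCoeff_snd_add 1 i)
  have hVa : ∀ᶠ x in 𝓝[>] (0 : ℝ), ∀ ρ, IsPolarSolution p q r (P a) (Q a) x ρ →
      EqOn ρ (IccExtend two_pi_nonneg (expCurve x (V (x, a)))) (Icc 0 (2 * Real.pi)) := by
    filter_upwards [hVu] with x hx ρ hρ φ hφ
    rw [IccExtend_of_mem _ _ hφ]
    exact hx ρ hρ ⟨φ, hφ⟩
  have hslice : Tendsto (fun x : ℝ => (x, a)) (𝓝 0) (𝓝 (0, a)) :=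
    Continuous.tendsto' (by fun_prop) _ _ rfl
  have hint' : ∀ᶠ x in 𝓝[>] (0 : ℝ), ∫ φ in (0 : ℝ)..(2 * Real.pi),
      polarCofactor p q r (P a) (Q a) K φ (IccExtend two_pi_nonneg (expCurve x (V (x, a))) φ)
        = s * Z (x, a) + Z (x, a) * Y (x, a) := by
    filter_upwards [hint, nhdsWithin_le_nhds (hslice.eventually hYe),
      nhdsWithin_le_nhds (hslice.eventually hVe), self_mem_nhdsWithin] with x h1 h2 h3 hx
    rw [h1.2, ← h2 hx, logQuotient, h3 hx, truncation_of_startsAt hFs]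
  refine ⟨hT.startsAt_cofactor hp hq hK hFs hFn, fun i => ⟨?_, ?_⟩, ?_, ?_, ?_,
    fun i => parCoeff i Y, y, analyticAt_parCoeff hY, hy, ?_⟩
  · exact (analyticAt_parCoeff (analyticAt_fst.mul h1Z) i).congr
      (hη.mono fun b hb => (hb i).symm)
  · exact (analyticAt_parCoeff hB i).congr (hβ.mono fun b hb => (hb i).symm)
  · rw [hη1.self_of_nhds]; exact hZ0
  · filter_upwards [hT.solution, hint, hint', hVa, nhdsWithin_le_nhds (hasSum_parCoeff hB),
      nhdsWithin_le_nhds (hasSum_parCoeff h1Z), self_mem_nhdsWithin] with x h1 h2 h3 h4 h5 h6 hx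
    refine ⟨⟨_, h1.2.1⟩, fun ρ hρ => ⟨?_, ?_, ?_⟩⟩
    · refine h2.1.congr fun φ hφ => ?_
      simp only [h4 ρ hρ hφ]
    · have : ∫ φ in (0 : ℝ)..(2 * Real.pi), polarCofactor p q r (P a) (Q a) K φ (ρ φ)
          = s * Z (x, a) + Z (x, a) * Y (x, a) := by
        rw [← h3]
        refine intervalIntegral.integral_congr fun φ hφ => ?_
        rw [uIcc_of_le two_pi_nonneg] at hφ
        simp only [h4 ρ hρ hφ]
      rw [this]
      simpa only [hβ.self_of_nhds] using h5
    · have : ρ (2 * Real.pi) = x * (1 + Z (x, a)) := by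
        rw [h4 ρ hρ (right_mem_Icc.2 two_pi_nonneg),
          IccExtend_of_mem _ _ (right_mem_Icc.2 two_pi_nonneg)]
        exact hexp (x, a)
      rw [this]
      refine (h6.mul_left x).congr_fun fun i => ?_
      rw [hηs.self_of_nhds]
      ring
  · intro n hn hKn i hi
    obtain ⟨C, hC⟩ := hT.integral_cofactor_le hp hq hK.analyticAt_cofactor hKn hn
    rw [hβ.self_of_nhds]
    refine parCoeff_eq_zero_of_le hB (C := C) ?_ i hi
    filter_upwards [hC, hint'] with x h1 h2
    rwa [h2] at h1
  · filter_upwards [hβ, hd, hη1, hY0, eventually_slice hZ.eventually_analyticAt,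
      eventually_slice hY.eventually_analyticAt] with b h1 h2 h3 h4 h5 h6
    have hZb := h5.self_of_nhds
    have hYb := h6.self_of_nhds
    refine ⟨fun i => ?_, ?_, ?_⟩
    · rw [h1, parCoeff_add (f := fun z => s * Z z) (g := fun z => Z z * Y z)
        (analyticAt_const.mul hZb) (hZb.mul hYb), parCoeff_const_mul,
        parCoeff_mul hZb hYb]
      simp only [h2]
    · rw [h2, parCoeff_zero, parCoeff_zero, h4.1]
    · rw [h1, parCoeff_zero, h3, h4.2]

lemma displacement_of_pos {X : Type*} (η : ℕ → X → ℝ) {j : ℕ} (hj : 0 < j) :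
    displacement η j = η (j + 1) := by
  obtain ⟨k, rfl⟩ := Nat.exists_eq_succ_of_ne_zero hj.ne'
  rfl

end Assembly

end MonodromicClass

/-! ### The main theorem. -/

open MonodromicClass in
theorem theorem3 {m : ℕ} (Λ : Set (EuclideanSpace ℝ (Fin m)))
    (p q r s : ℕ) (hp : 0 < p) (hq : 0 < q) (hpq : Nat.Coprime p q)
    (P Q F K : EuclideanSpace ℝ (Fin m) → ℝ → ℝ → ℝ)
    (hP : ∀ a ∈ Λ, AnalyticAt ℝ
      (fun z : ℝ × ℝ × EuclideanSpace ℝ (Fin m) => P z.2.2 z.1 z.2.1) (0, 0, a))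
    (hQ : ∀ a ∈ Λ, AnalyticAt ℝ
      (fun z : ℝ × ℝ × EuclideanSpace ℝ (Fin m) => Q z.2.2 z.1 z.2.1) (0, 0, a))
    (hMo : ∀ a ∈ Λ, InMo p q r (P a) (Q a))
    (hF : ∀ a ∈ Λ, AnalyticAt ℝ
      (fun z : ℝ × ℝ × EuclideanSpace ℝ (Fin m) => F z.2.2 z.1 z.2.1) (0, 0, a))
    (hF0 : ∀ a ∈ Λ, F a 0 0 = 0)
    (hFs : ∀ a ∈ Λ, StartsAt p q (F a) s ∧ ∃ x y : ℝ, qhPart p q (F a) s x y ≠ 0)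
    (hK : ∀ a ∈ Λ, IsCofactor (P a) (Q a) (F a) (K a)) :
    (∀ a ∈ Λ, StartsAt p q (K a) r) ∧
    ∃ η β : ℕ → EuclideanSpace ℝ (Fin m) → ℝ,
      (∀ a ∈ Λ, ∀ i, AnalyticAt ℝ (η i) a ∧ AnalyticAt ℝ (β i) a) ∧
      (∀ a ∈ Λ, 0 < η 1 a) ∧
      (∀ a ∈ Λ, ∃ δ > 0, ∀ ρ₀ ∈ Set.Ioo 0 δ,
        (∃ ρ, IsPolarSolution p q r (P a) (Q a) ρ₀ ρ) ∧
        ∀ ρ, IsPolarSolution p q r (P a) (Q a) ρ₀ ρ →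
          ContinuousOn (fun φ => polarCofactor p q r (P a) (Q a) (K a) φ (ρ φ))
            (Set.Icc 0 (2 * Real.pi)) ∧
          HasSum (fun i => β i a * ρ₀ ^ i)
            (∫ φ in (0 : ℝ)..(2 * Real.pi), polarCofactor p q r (P a) (Q a) (K a) φ (ρ φ)) ∧
          HasSum (fun i => η (i + 1) a * ρ₀ ^ (i + 1)) (ρ (2 * Real.pi))) ∧
      ∀ rb, r ≤ rb → (∀ a ∈ Λ, StartsAt p q (K a) rb) →
        (∀ i < rb - r, ∀ a ∈ Λ, β i a = 0) ∧
        (rb - r = 0 →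
          (∀ a ∈ Λ, β 0 a = Real.log (η 1 a ^ s)) ∧
          ∀ i > 0, ∀ a ∈ Λ,
            GermCongr Λ a ({fun b => η 1 b - 1} ∪ η '' Set.Icc 2 i)
              (β i) (fun b => s * η (i + 1) b)) ∧
        (1 ≤ rb - r →
          (∀ a ∈ Λ, η 1 a = 1) ∧
          (∀ j ∈ Set.Icc 2 (rb - r), ∀ a ∈ Λ, η j a = 0) ∧
          (∀ a ∈ Λ, β (rb - r) a = s * η (rb - r + 1) a) ∧
          ∀ i > rb - r, ∀ a ∈ Λ,
            GermCongr Λ a (η '' Set.Icc (rb - r + 1) i)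
              (β i) (fun b => s * η (i + 1) b)) := by
  have key := fun a (ha : a ∈ Λ) => exists_coefficients hp hq (hP a ha) (hQ a ha) (hMo a ha)
    (hF a ha) (hFs a ha).1 (hFs a ha).2 (hK a ha)
  refine ⟨fun a ha => (key a ha).1, returnCoeff p q r P Q, cofactorCoeff p q r s P Q F,
    fun a ha => (key a ha).2.1, fun a ha => (key a ha).2.2.1, fun a ha => ?_, ?_⟩
  · obtain ⟨δ, hδ, hs⟩ := mem_nhdsGT_iff_exists_Ioo_subset.1 (key a ha).2.2.2.1
    exact ⟨δ, hδ, fun x hx => hs hx⟩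
  intro rb hrb hKrb
  generalize hη : returnCoeff p q r P Q = η at key ⊢
  generalize hβ : cofactorCoeff p q r s P Q F = β at key ⊢
  have hβ0 : ∀ i < rb - r, ∀ a ∈ Λ, β i a = 0 := fun i hi a ha =>
    (key a ha).2.2.2.2.1 rb hrb (hKrb a ha) i hi
  have hcongr : ∀ a ∈ Λ, ∀ i > 0, ∀ S : Set (EuclideanSpace ℝ (Fin m) → ℝ),
      (∀ j < i, displacement η j ∈ S ∨ ∀ᶠ b in 𝓝[Λ] a, displacement η j b = 0) →
      GermCongr Λ a S (β i) (fun b => s * η (i + 1) b) := by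
    intro a ha i hi S hS
    obtain ⟨-, han, -, -, -, c, y, hc, hy, he⟩ := key a ha
    exact germCongr_of_expansion (fun i => (han i).1) hc hy hi (he.mono fun b hb => hb.1 i)
      (he.mono fun b hb => hb.2.1) hS
  refine ⟨hβ0, fun _ => ⟨fun a ha => ?_, fun i hi a ha => ?_⟩, fun hn => ?_⟩
  · obtain ⟨-, -, -, -, -, c, y, -, -, he⟩ := key a ha
    rw [he.self_of_nhds.2.2, Real.log_pow]
  · refine hcongr a ha i hi _ fun j hj => Or.inl ?_
    rcases Nat.eq_zero_or_pos j with rfl | hj0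
    · exact Or.inl rfl
    · rw [displacement_of_pos η hj0]
      exact Or.inr ⟨j + 1, ⟨by omega, by omega⟩, rfl⟩
  · have hz : ∀ a ∈ Λ, (∀ i < rb - r, displacement η i a = 0) ∧
        β (rb - r) a = s * displacement η (rb - r) a := by
      intro a ha
      obtain ⟨-, -, hη1, -, -, c, y, -, -, he⟩ := key a ha
      obtain ⟨h1, h2, h3⟩ := he.self_of_nhds
      have := displacement_eq_zero (pos_of_apply_zero_eq_zero (hF0 a ha) (hFs a ha).2) hη1
        h1 h2 h3 fun i hi => hβ0 i hi a ha
      exact ⟨this.1, this.2 hn⟩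
    refine ⟨fun a ha => ?_, fun j hj a ha => ?_, fun a ha => ?_, fun i hi a ha => ?_⟩
    · exact sub_eq_zero.1 ((hz a ha).1 0 hn)
    · obtain ⟨k, rfl⟩ := Nat.exists_eq_add_of_le' hj.1
      exact (hz a ha).1 (k + 1) (by have := hj.2; omega)
    · rw [(hz a ha).2, displacement_of_pos η hn]
    · refine hcongr a ha i (by omega) _ fun j hj => ?_
      rcases lt_or_ge j (rb - r) with h | h
      -- The coefficients of index below `r̄ - r` vanish at every point of `Λ`, hence as germs along
      -- `Λ`, and are not needed among the generators.
      · exact Or.inr (eventually_mem_nhdsWithin.mono fun b hb => (hz b hb).1 j h)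
      · rw [displacement_of_pos η (by omega)]
        exact Or.inl ⟨j + 1, ⟨by omega, by omega⟩, rfl⟩
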